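/- Let $x_0\in\mathbb R^n$ be an unknown parameter and consider $N$ nodes $\mathcal V=\{1,\dots,N\}$ communicating over random digraphs with (real, not necessarily nonnegative) weighted adjacency matrices $\mathcal A(k)=[w_{ij}(k)]$, $k\ge 0$, having zero diagonal; $(j,i)$ is an edge at instant $k$ iff $w_{ij}(k)\neq 0$, $\mathcal N_i(k)=\{j: w_{ij}(k)\ne 0\}$, and $\mathcal L(k)=\mathrm{diag}\big(\sum_j w_{1j}(k),\dots,\sum_j w_{Nj}(k)\big)-\mathcal A(k)$ is the Laplacian, $\widehat{\mathcal L}(k)=\frac12(\mathcal L(k)+\mathcal L(k)^{T})$. Node $i$ observes $y_i(k)=H_i(k)x_0+v_i(k)\in\mathbb R^{n_i}$ with random regression matrices $H_i(k)\in\mathbb R^{n_i\times n}$ and measurement noises $v_i(k)$, and receives from $j\in\mathcal N_i(k)$ the value $\mu_{ji}(k)=x_j(k)+f_{ji}(x_j(k)-x_i(k))\,\xi_{ji}(k)$, with communication noises $\xi_{ji}(k)\in\mathbb R^n$ and noise intensity functions $f_{ji}:\mathbb R^n\to\mathbb R$. With deterministic initial values $x_i(0)\in\mathbb R^n$ and deterministic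 gains $a(k),b(k)\in\mathbb R$, the algorithm without regularization is $$x_i(k+1)=x_i(k)+a(k)H_i^{T}(k)\big(y_i(k)-H_i(k)x_i(k)\big)+b(k)\sum_{j\in\mathcal N_i(k)}w_{ij}(k)\big(\mu_{ji}(k)-x_i(k)\big),\quad k\ge 0,\ i\in\mathcal V.$$ Let $\mathcal F(k)$ be the $\sigma$-algebra generated by $\mathcal A(s),H_i(s),v_i(s),\xi_{ji}(s)$, $i,j\in\mathcal V$, $0\le s\le k$, let $\mathcal F(-1)$ be trivial, let $\mathcal H(k)=\mathrm{diag}(H_1(k),\dots,H_N(k))$ (block diagonal), let $v(k)$ and $\xi(k)$ be the vectors of all $v_i(k)$ and of all $\xi_{ji}(k)$, and for a positive integer $h$ put $$\Lambda_k^h=\lambda_{\min}\Big[\sum_{i=kh}^{(k+1)h-1}\Big(b(i)\,\mathbb E\big[\widehat{\mathcal L}(i)\,\big|\,\mathcal F(kh-1)\big]\otimes I_n+a(i)\,\mathbb E\big[\mathcal H^{T}(i)\mathcal H(i)\,\big|\,\mathcal F(kh-1)\big]\Big)\Big],\quad k\ge 0.$$ Assume: (A1) there are constants $\sigma,c$ with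 $|f_{ji}(x)|\le\sigma\|x\|+c$ for all $x\in\mathbb R^n$ and all $i,j$; (A2) $\{v(k),\mathcal F(k)\}$ and $\{\xi(k),\mathcal F(k)\}$ are martingale difference sequences, the noises $\{v(k),\xi(k),k\ge0\}$ are (jointly) independent of $\{\mathcal H(k),\mathcal A(k),k\ge0\}$, and there is a constant $\beta_v$ with $\sup_{k\ge0}\mathbb E[\|v(k)\|^2+\|\xi(k)\|^2\,|\,\mathcal F(k-1)]\le\beta_v$ a.s. Suppose that there are a positive integer $h$ and a constant $\rho_0>0$ such that (i) $\sum_{k=0}^\infty\Lambda_k^h=\infty$ a.s. and $\inf_{k\ge0}\Lambda_k^h\ge0$ a.s.; (ii) $\sum_{k=0}^\infty(a^2(k)+b^2(k))<\infty$; (iii) $\sup_{k\ge0}\Big(\|\mathcal L(k)\|+\big(\mathbb E\big[\|\mathcal H^{T}(k)\mathcal H(k)\|^{2^{\max\{h,2\}}}\,\big|\,\mathcal F(k-1)\big]\big)^{2^{-\max\{h,2\}}}\Big)\le\rho_0$ a.s., with spectral norms. Then $\lim_{k\to\infty}x_i(k)=x_0$ for all $i\in\mathcal V$, almost surely. -/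

import Mathlib

open MeasureTheory ProbabilityTheory Filter
open scoped Topology Kronecker Matrix.Norms.L2Operator

noncomputable section

namespace DecentralizedRegression

/-- The data of a decentralized linear regression problem over a sequence of random weighted
digraphs with `N` nodes: unknown parameter in `ℝⁿ`, observations of node `i` in `ℝ^(d i)`.
The graph at instant `k` is given by its weighted adjacency matrix, a random real matrix with zero
diagonal (weights of either sign are allowed). -/
structure Model (Ω : Type*) [MeasurableSpace Ω] (N n : ℕ) (d : Fin N → ℕ) where
  /-- the unknown true parameter vector -/
  x₀ : EuclideanSpace ℝ (Fin n)
  /-- `A k ω` is the weighted adjacency matrix `[w_ij(k)]` -/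
  A : ℕ → Ω → Matrix (Fin N) (Fin N) ℝ
  /-- `H i k ω` is the regression matrix of node `i` at instant `k` -/
  H : (i : Fin N) → ℕ → Ω → Matrix (Fin (d i)) (Fin n) ℝ
  /-- `v i k ω` is the measurement noise of node `i` at instant `k` -/
  v : (i : Fin N) → ℕ → Ω → EuclideanSpace ℝ (Fin (d i))
  /-- `ξ j i k ω` is the communication noise `ξ_ji(k)` on the channel from node `j` to node `i` -/
  ξ : Fin N → Fin N → ℕ → Ω → EuclideanSpace ℝ (Fin n)
  /-- `f j i` is the noise intensity function `f_ji` -/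
  f : Fin N → Fin N → EuclideanSpace ℝ (Fin n) → ℝ
  A_diag : ∀ k ω i, A k ω i i = 0
  measurable_A : ∀ k i j, Measurable fun ω => A k ω i j
  measurable_H : ∀ i k r c, Measurable fun ω => H i k ω r c
  measurable_v : ∀ i k, Measurable (v i k)
  measurable_ξ : ∀ j i k, Measurable (ξ j i k)
  measurable_f : ∀ j i, Measurable (f j i)

variable {Ω : Type*} [MeasurableSpace Ω] {N n : ℕ} {d : Fin N → ℕ}

namespace Model

/-! ### The algorithm -/

/-- The observation `y_i(k) = H_i(k) x₀ + v_i(k)`. -/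
def y (M : Model Ω N n d) (i : Fin N) (k : ℕ) (ω : Ω) : EuclideanSpace ℝ (Fin (d i)) :=
  Matrix.toEuclideanLin (M.H i k ω) M.x₀ + M.v i k ω

open scoped Classical in
/-- The neighborhood of node `i` at instant `k`: those `j` for which `(j, i)` is an edge, that is,
`w_ij(k) ≠ 0`. -/
def neighbors (M : Model Ω N n d) (k : ℕ) (ω : Ω) (i : Fin N) : Finset (Fin N) :=
  Finset.univ.filter fun j => M.A k ω i j ≠ 0

/-- What node `i` receives from node `j` at instant `k` when the current estimates are `x`:
`μ_ji(k) = x_j + f_ji(x_j - x_i) ξ_ji(k)`. -/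
def received (M : Model Ω N n d) (k : ℕ) (ω : Ω) (x : Fin N → EuclideanSpace ℝ (Fin n))
    (j i : Fin N) : EuclideanSpace ℝ (Fin n) :=
  x j + M.f j i (x j - x i) • M.ξ j i k ω

/-- The estimates `x_i(k)` produced by the decentralized online regularized algorithm with
innovation gains `a`, consensus gains `b`, regularization gains `lam` and initial estimates
`init`. -/
def estimate (M : Model Ω N n d) (a b lam : ℕ → ℝ) (init : Fin N → EuclideanSpace ℝ (Fin n)) :
    ℕ → Ω → Fin N → EuclideanSpace ℝ (Fin n)
  | 0, _ => init
  | k + 1, ω => fun i =>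
      M.estimate a b lam init k ω i
        + a k • Matrix.toEuclideanLin (M.H i k ω).transpose
            (M.y i k ω - Matrix.toEuclideanLin (M.H i k ω) (M.estimate a b lam init k ω i))
        + b k • ∑ j ∈ M.neighbors k ω i, M.A k ω i j •
            (M.received k ω (M.estimate a b lam init k ω) j i - M.estimate a b lam init k ω i)
        - lam k • M.estimate a b lam init k ω i

/-! ### Information available to the network -/

/-- The `σ`-algebra generated by all regression matrices and the graph at instant `s`. -/
@[reducible] def regressorSigma (M : Model Ω N n d) (s : ℕ) : MeasurableSpace Ω :=
  (⨆ i, ⨆ j, MeasurableSpace.comap (fun ω => M.A s ω i j) inferInstance) ⊔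
    ⨆ i, ⨆ r, ⨆ c, MeasurableSpace.comap (fun ω => M.H i s ω r c) inferInstance

/-- The `σ`-algebra generated by all measurement and communication noises at instant `s`. -/
@[reducible] def noiseSigma (M : Model Ω N n d) (s : ℕ) : MeasurableSpace Ω :=
  (⨆ i, MeasurableSpace.comap (M.v i s) inferInstance) ⊔
    ⨆ j, ⨆ i, MeasurableSpace.comap (M.ξ j i s) inferInstance

/-- `M.past k` is `ℱ(k - 1)`, the `σ`-algebra generated by the graphs, the regression matrices and
the noises at the instants `0, …, k - 1`; in particular `M.past 0` is trivial. -/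
@[reducible] def past (M : Model Ω N n d) (k : ℕ) : MeasurableSpace Ω :=
  ⨆ s, ⨆ _ : s < k, M.regressorSigma s ⊔ M.noiseSigma s

/-! ### Laplacian and information matrices -/

/-- The Laplacian matrix `𝓛(k) = 𝓓(k) - 𝓐(k)`, with the in-degrees `∑ j, w_ij(k)` in `𝓓(k)`. -/
def laplacian (M : Model Ω N n d) (k : ℕ) (ω : Ω) : Matrix (Fin N) (Fin N) ℝ :=
  Matrix.diagonal (fun i => ∑ j, M.A k ω i j) - M.A k ω

/-- The symmetrized Laplacian matrix `(𝓛(k) + 𝓛(k)ᵀ) / 2`. -/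
def symLaplacian (M : Model Ω N n d) (k : ℕ) (ω : Ω) : Matrix (Fin N) (Fin N) ℝ :=
  (2⁻¹ : ℝ) • (M.laplacian k ω + (M.laplacian k ω).transpose)

/-- The block diagonal matrix `𝓗(k) = diag(H_1(k), …, H_N(k))`. -/
def blockH (M : Model Ω N n d) (k : ℕ) (ω : Ω) :
    Matrix ((i : Fin N) × Fin (d i)) (Fin N × Fin n) ℝ :=
  Matrix.of fun p q => if p.1 = q.1 then M.H p.1 k ω p.2 q.2 else 0

/-- The Gram matrix `𝓗(k)ᵀ 𝓗(k)`. -/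
def gram (M : Model Ω N n d) (k : ℕ) (ω : Ω) : Matrix (Fin N × Fin n) (Fin N × Fin n) ℝ :=
  (M.blockH k ω).transpose * M.blockH k ω

end Model

/-- The entrywise conditional expectation of a random matrix. -/
def condExpMatrix {ι κ : Type*} (μ : Measure Ω) (m : MeasurableSpace Ω)
    (X : Ω → Matrix ι κ ℝ) (ω : Ω) : Matrix ι κ ℝ :=
  Matrix.of fun i j => (μ[fun ω' => X ω' i j | m]) ω

/-- The minimum eigenvalue of a (symmetric) real matrix, as the least element of its real
spectrum. -/
def lambdaMin {ι : Type*} [Fintype ι] [DecidableEq ι] (B : Matrix ι ι ℝ) : ℝ :=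
  sInf (spectrum ℝ B)

/-- `(X k)` is a martingale difference sequence, where `past k` is the information available
strictly before instant `k`: `X k` is known at instant `k`, integrable, and has conditional mean
zero given `past k`. -/
structure IsMartingaleDifference {E : Type*} [NormedAddCommGroup E] [NormedSpace ℝ E]
    [CompleteSpace E] (μ : Measure Ω) (past : ℕ → MeasurableSpace Ω) (X : ℕ → Ω → E) : Prop where
  adapted : ∀ k, StronglyMeasurable[past (k + 1)] (X k)
  integrable : ∀ k, Integrable (X k) μ
  condExp_eq_zero : ∀ k, μ[X k | past k] =ᵐ[μ] 0

namespace Model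

/-- `Λ_k^h`: the minimum eigenvalue of
`∑_{i = kh}^{(k+1)h-1} (b(i) E[𝓛̂(i) | ℱ(kh-1)] ⊗ I_n + a(i) E[𝓗ᵀ(i) 𝓗(i) | ℱ(kh-1)])`. -/
def infoEigenvalue (M : Model Ω N n d) (μ : Measure Ω) (a b : ℕ → ℝ) (h k : ℕ) (ω : Ω) : ℝ :=
  lambdaMin (∑ i ∈ Finset.Ico (k * h) ((k + 1) * h),
    (b i • (condExpMatrix μ (M.past (k * h)) (M.symLaplacian i) ω ⊗ₖ
        (1 : Matrix (Fin n) (Fin n) ℝ))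
      + a i • condExpMatrix μ (M.past (k * h)) (M.gram i) ω))

/-! ### Assumptions -/

/-- The noise intensity functions grow at most linearly: `|f_ji(x)| ≤ σ ‖x‖ + c`. -/
def LinearGrowth (M : Model Ω N n d) : Prop :=
  ∃ σ c : ℝ, ∀ j i x, |M.f j i x| ≤ σ * ‖x‖ + c

/-- The squared norm `‖v(k)‖² + ‖ξ(k)‖²` of all noises at instant `k`. -/
def noiseSq (M : Model Ω N n d) (k : ℕ) (ω : Ω) : ℝ :=
  (∑ i, ‖M.v i k ω‖ ^ 2) + ∑ j, ∑ i, ‖M.ξ j i k ω‖ ^ 2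

/-- The noises are martingale differences, (jointly) independent of the regression matrices and
graphs, with uniformly bounded conditional second moments. -/
structure NoiseAssumption (M : Model Ω N n d) (μ : Measure Ω) : Prop where
  martingale_v : ∀ i, IsMartingaleDifference μ M.past (M.v i)
  martingale_ξ : ∀ j i, IsMartingaleDifference μ M.past (M.ξ j i)
  indep : Indep (⨆ k, M.noiseSigma k) (⨆ k, M.regressorSigma k) μ
  integrable_sq : ∀ k, Integrable (M.noiseSq k) μ
  bounded : ∃ β : ℝ, ∀ᵐ ω ∂μ, ∀ k, (μ[M.noiseSq k | M.past k]) ω ≤ β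

/-- The uniform bound
`sup_k (‖𝓛(k)‖ + (E[‖𝓗ᵀ(k) 𝓗(k)‖ ^ p | ℱ(k-1)]) ^ (1/p)) ≤ ρ` a.s., `p = 2 ^ max {h, 2}`, with
spectral norms (the moments being finite is part of the bound). -/
structure UniformBound (M : Model Ω N n d) (μ : Measure Ω) (h : ℕ) (ρ : ℝ) : Prop where
  integrable : ∀ k, Integrable (fun ω => ‖M.gram k ω‖ ^ (2 ^ max h 2)) μ
  bound : ∀ᵐ ω ∂μ, ∀ k, ‖M.laplacian k ω‖ +
    ((μ[fun ω' => ‖M.gram k ω'‖ ^ (2 ^ max h 2) | M.past k]) ω) ^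
      ((1 : ℝ) / 2 ^ max h 2) ≤ ρ

end Model

end DecentralizedRegression

end

set_option linter.unusedSectionVars false

/-! Stack the estimation errors into one vector e(k). Laplacian rows sum to zero, so x₀ cancels from
the consensus term and e(k+1) = e(k) − D(k)e(k) + m(k), where D(k) = b(k)𝓛(k)⊗I + a(k)𝓗ᵀ(k)𝓗(k) and
m(k) collects the noises. With g(k) = a(k)² + b(k)², both D(k)e(k) and m(k) have conditional mean
square O(g(k)(‖e(k)‖² + 1)), and ∑ g < ∞.

A single step need not contract, even on average; only a block of h steps is informative. Inside a
block, ⟨e(i), D(i)e(i)⟩ is replaced by the frozen form ⟨e(kh), D(i)e(kh)⟩. Since D(i) and e(i) −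
e(kh) are both of mean-square order g, this costs a multiple of the block sum of g
(`inner_apply_sub_le`, `exists_setIntegral_block_le`). Given ℱ(kh−1), the frozen forms add up to the
quadratic form of the matrix whose least eigenvalue is Λ_k (`infoEigenvalue_mul_le`). Hence Y_k =
‖e(kh)‖² + 1 satisfies E[Y_{k+1} | ℱ(kh−1)] ≤ (1 + β_k)Y_k − R_k with R_k ≥ 2Λ_k‖e(kh)‖² and ∑ β_k <
∞. By Robbins–Siegmund (`almostSupermartingale_ae_tendsto`), ‖e(kh)‖² converges and ∑ Λ_k‖e(kh)‖² <
∞; as ∑ Λ_k = ∞, the limit is 0. Mean-square displacements within blocks are summable, which carries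
the limit to all instants.

The delicate point is m(k), which multiplies v(k) and ξ(k) by 𝓗(k) and 𝓐(k), unknown to the past.
The conditioning is therefore on the earlier noises together with the whole sequence of graphs and
regressors; independence preserves the zero mean and the variance bound (`condExp_enlargedPast_eq`).

Conditional inequalities are mostly expressed as inequalities between integrals over events of the
past. -/

namespace DecentralizedRegression

/-! ### Conditional expectation: products and independence -/

section ConditionalTools

variable {Ω : Type*} {m mΩ : MeasurableSpace Ω} {μ : Measure Ω} [IsFiniteMeasure μ]

/-- Integrability of the product is not free, since neither factor is bounded. Restricted to the
smaller σ-algebra, the measure Y dμ is dominated by C μ, and X is measurable there, so ∫ XY ≤ C ∫ X.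
-/
theorem integrable_mul_of_condExp_le (hm : m ≤ mΩ) {X Y : Ω → ℝ} {C : ℝ}
    (hX : StronglyMeasurable[m] X) (hXi : Integrable X μ) (hX0 : ∀ ω, 0 ≤ X ω)
    (hYi : Integrable Y μ) (hY0 : ∀ ω, 0 ≤ Y ω) (hC : ∀ᵐ ω ∂μ, (μ[Y | m]) ω ≤ C) :
    Integrable (fun ω => X ω * Y ω) μ := by
  have htrim : (μ.withDensity fun ω => ENNReal.ofReal (Y ω)).trim hm
      ≤ (ENNReal.ofReal C) • μ.trim hm := by
    refine Measure.le_intro fun s hs _ => ?_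
    rw [trim_measurableSet_eq hm hs, Measure.smul_apply, trim_measurableSet_eq hm hs,
      withDensity_apply _ (hm s hs), ← ofReal_integral_eq_lintegral_ofReal hYi.integrableOn
        (ae_of_all _ hY0), ← setIntegral_condExp hm hYi hs, smul_eq_mul,
      ← ofReal_measureReal (measure_ne_top μ s), ← ENNReal.ofReal_mul' measureReal_nonneg]
    refine ENNReal.ofReal_le_ofReal ?_
    calc ∫ ω in s, (μ[Y | m]) ω ∂μ ≤ ∫ _ in s, C ∂μ :=
          integral_mono_ae integrable_condExp.integrableOn (integrable_const _)
            (ae_restrict_of_ae hC)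
      _ = C * μ.real s := by simp [mul_comm]
  refine ⟨(hX.mono hm).aestronglyMeasurable.mul hYi.1, ?_⟩
  have hXm : Measurable[m] fun ω => ENNReal.ofReal (X ω) := hX.measurable.ennreal_ofReal
  have h1 : ∫⁻ ω, ENNReal.ofReal (X ω) * ENNReal.ofReal (Y ω) ∂μ
      ≤ ENNReal.ofReal C * ∫⁻ ω, ENNReal.ofReal (X ω) ∂μ := by
    calc ∫⁻ ω, ENNReal.ofReal (X ω) * ENNReal.ofReal (Y ω) ∂μ
        = ∫⁻ ω, ENNReal.ofReal (X ω) ∂(μ.withDensity fun ω => ENNReal.ofReal (Y ω)) := by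
          rw [lintegral_withDensity_eq_lintegral_mul₀ hYi.1.aemeasurable.ennreal_ofReal
            (hXm.mono hm le_rfl).aemeasurable]
          simp [mul_comm]
      _ = ∫⁻ ω, ENNReal.ofReal (X ω) ∂((μ.withDensity fun ω => ENNReal.ofReal (Y ω)).trim hm) :=
          (lintegral_trim hm hXm).symm
      _ ≤ ∫⁻ ω, ENNReal.ofReal (X ω) ∂((ENNReal.ofReal C) • μ.trim hm) :=
          lintegral_mono' htrim le_rfl
      _ = _ := by rw [lintegral_smul_measure, lintegral_trim hm hXm, smul_eq_mul]
  rw [hasFiniteIntegral_iff_ofReal (ae_of_all _ fun ω => mul_nonneg (hX0 ω) (hY0 ω))]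
  simp_rw [fun ω => ENNReal.ofReal_mul (q := Y ω) (hX0 ω)]
  refine h1.trans_lt (ENNReal.mul_lt_top ENNReal.ofReal_lt_top ?_)
  rw [← hasFiniteIntegral_iff_ofReal (ae_of_all _ hX0)]
  exact hXi.2

theorem setIntegral_mul_le_of_condExp_le (hm : m ≤ mΩ) {X Y : Ω → ℝ} {C : ℝ}
    (hX : StronglyMeasurable[m] X) (hXi : Integrable X μ) (hX0 : ∀ ω, 0 ≤ X ω)
    (hYi : Integrable Y μ) (hY0 : ∀ ω, 0 ≤ Y ω) (hC : ∀ᵐ ω ∂μ, (μ[Y | m]) ω ≤ C)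
    {s : Set Ω} (hs : MeasurableSet[m] s) :
    ∫ ω in s, X ω * Y ω ∂μ ≤ C * ∫ ω in s, X ω ∂μ := by
  have hXY := integrable_mul_of_condExp_le hm hX hXi hX0 hYi hY0 hC
  rw [← setIntegral_condExp hm hXY hs, ← integral_const_mul]
  refine integral_mono_ae integrable_condExp.integrableOn (hXi.const_mul C).integrableOn
    (ae_restrict_of_ae ?_)
  filter_upwards [hC, condExp_mul_of_stronglyMeasurable_left hX hXY hYi] with ω h1 h2
  change (μ[X * Y | m]) ω ≤ _
  rw [h2, mul_comm C]
  exact mul_le_mul_of_nonneg_left h1 (hX0 ω)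

theorem setIntegral_eq_of_indep {E : Type*} [NormedAddCommGroup E] [NormedSpace ℝ E]
    [CompleteSpace E] {m₁ m₂ : MeasurableSpace Ω} (h₁ : m₁ ≤ mΩ) (h₂ : m₂ ≤ mΩ)
    (hind : Indep m₁ m₂ μ) {f : Ω → E} (hf : StronglyMeasurable[m₁] f) (hfi : Integrable f μ)
    {s : Set Ω} (hs : MeasurableSet[m₂] s) :
    ∫ ω in s, f ω ∂μ = μ.real s • ∫ ω, f ω ∂μ := by
  rw [← setIntegral_condExp h₂ hfi hs, ← setIntegral_const]
  exact integral_congr_ae (ae_restrict_of_ae (condExp_indep_eq h₁ h₂ hf hind))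

/-- Events A ∩ B with A in `m'` and B in `m₂` form a π-system generating the join. On these,
independence factors μ(B) out of the integrals of both `f` and its conditional expectation; a π-λ
argument extends the equality. -/
theorem condExp_sup_of_indep {E : Type*} [NormedAddCommGroup E] [NormedSpace ℝ E]
    [CompleteSpace E] {m' m₁ m₂ : MeasurableSpace Ω} (h₁ : m₁ ≤ mΩ) (h₂ : m₂ ≤ mΩ)
    (hm' : m' ≤ m₁) (hind : Indep m₁ m₂ μ) {f : Ω → E} (hf : StronglyMeasurable[m₁] f)
    (hfi : Integrable f μ) : μ[f | m' ⊔ m₂] =ᵐ[μ] μ[f | m'] := by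
  have hsup : m' ⊔ m₂ ≤ mΩ := sup_le (hm'.trans h₁) h₂
  symm
  refine ae_eq_condExp_of_forall_setIntegral_eq hsup hfi
    (fun s _ _ => integrable_condExp.integrableOn) ?_
    (stronglyMeasurable_condExp.mono le_sup_left).aestronglyMeasurable
  suffices H : ∀ s, MeasurableSet[m' ⊔ m₂] s → ∫ x in s, (μ[f | m']) x ∂μ = ∫ x in s, f x ∂μ from
    fun s hs _ => H s hs
  have hgen : m' ⊔ m₂ = MeasurableSpace.generateFrom
      (Set.image2 (· ∩ ·) {s | MeasurableSet[m'] s} {s | MeasurableSet[m₂] s}) := by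
    refine le_antisymm (sup_le (fun A hA => ?_) fun B hB => ?_)
      (MeasurableSpace.generateFrom_le ?_)
    · exact MeasurableSpace.measurableSet_generateFrom ⟨A, hA, Set.univ, MeasurableSet.univ, by simp⟩
    · exact MeasurableSpace.measurableSet_generateFrom ⟨Set.univ, MeasurableSet.univ, B, hB, by simp⟩
    · rintro _ ⟨A, hA, B, hB, rfl⟩
      exact MeasurableSet.inter (le_sup_left (a := m') A hA) (le_sup_right (b := m₂) B hB)
  have hpi : IsPiSystem
      (Set.image2 (· ∩ ·) {s | MeasurableSet[m'] s} {s | MeasurableSet[m₂] s}) := by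
    rintro _ ⟨A, hA, B, hB, rfl⟩ _ ⟨A', hA', B', hB', rfl⟩ _
    exact ⟨A ∩ A', MeasurableSet.inter hA hA', B ∩ B', MeasurableSet.inter hB hB',
      Set.inter_inter_inter_comm _ _ _ _⟩
  intro s hs
  induction s, hs using MeasurableSpace.induction_on_inter hgen hpi with
  | empty => simp
  | basic t ht =>
    obtain ⟨A, hA, B, hB, rfl⟩ := ht
    have hA1 := hm' A hA
    have key : ∀ φ : Ω → E, StronglyMeasurable[m₁] φ → Integrable φ μ →
        ∫ x in A ∩ B, φ x ∂μ = μ.real B • ∫ x in A, φ x ∂μ := by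
      intro φ hφ hφi
      rw [Set.inter_comm, ← setIntegral_indicator (h₁ A hA1), ← integral_indicator (h₁ A hA1)]
      exact setIntegral_eq_of_indep h₁ h₂ hind (hφ.indicator hA1)
        (hφi.indicator (h₁ A hA1)) hB
    rw [key _ (stronglyMeasurable_condExp.mono hm') integrable_condExp, key f hf hfi,
      setIntegral_condExp (hm'.trans h₁) hfi hA]
  | compl t ht ih =>
    have e1 := integral_add_compl (hsup t ht) (integrable_condExp (m := m') (μ := μ) (f := f))
    have e2 := integral_add_compl (hsup t ht) hfi
    rw [integral_condExp (hm'.trans h₁), ← e2, ih] at e1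
    exact add_left_cancel e1
  | iUnion t hd ht ih =>
    rw [integral_iUnion (fun i => hsup _ (ht i)) hd integrable_condExp.integrableOn,
      integral_iUnion (fun i => hsup _ (ht i)) hd hfi.integrableOn]
    simp_rw [ih]

end ConditionalTools

/-- Subtracting `lambdaMin B` times the identity shifts the spectrum into the nonnegative reals, so
the difference is positive semidefinite. -/
theorem lambdaMin_mul_norm_sq_le {ι : Type*} [Fintype ι] [DecidableEq ι] {B : Matrix ι ι ℝ}
    (hB : B.IsHermitian) (x : EuclideanSpace ℝ ι) :
    lambdaMin B * ‖x‖ ^ 2 ≤ inner ℝ x (Matrix.toEuclideanCLM (𝕜 := ℝ) B x) := by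
  have hfin : (spectrum ℝ B).Finite := by
    rw [hB.spectrum_eq_image_range]; exact (Set.finite_range _).image _
  have hps : (B - algebraMap ℝ (Matrix ι ι ℝ) (lambdaMin B)).PosSemidef := by
    rw [Matrix.posSemidef_iff_isHermitian_and_spectrum_nonneg]
    refine ⟨hB.sub ?_, ?_⟩
    · simp [Matrix.IsHermitian, Algebra.algebraMap_eq_smul_one]
    · rw [← spectrum.sub_singleton_eq]
      rintro _ ⟨a, ha, b, rfl, rfl⟩
      exact sub_nonneg.2 (csInf_le hfin.bddBelow ha)
  have h := hps.dotProduct_mulVec_nonneg x.ofLp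
  rw [Matrix.sub_mulVec, dotProduct_sub] at h
  rw [Matrix.inner_toEuclideanCLM]
  have hx : star x.ofLp ⬝ᵥ (algebraMap ℝ (Matrix ι ι ℝ) (lambdaMin B)).mulVec x.ofLp
      = lambdaMin B * ‖x‖ ^ 2 := by
    rw [EuclideanSpace.norm_sq_eq, Finset.mul_sum]
    simp [Algebra.algebraMap_eq_smul_one, Matrix.smul_mulVec, dotProduct, pow_two, mul_left_comm]
  rw [hx] at h
  simpa using h

end DecentralizedRegression

namespace DecentralizedRegression

/-! ### Mean-square estimates for an abstract stochastic recursion -/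

section Recursion

variable {Ω E : Type*} {mΩ : MeasurableSpace Ω} [NormedAddCommGroup E] [InnerProductSpace ℝ E]

theorem integrable_norm_sq_of_memLp {μ : Measure Ω} {f : Ω → E} (hf : MemLp f 2 μ) :
    Integrable (fun ω => ‖f ω‖ ^ 2) μ :=
  (memLp_two_iff_integrable_sq_norm hf.1).1 hf

theorem integrable_inner_of_memLp {μ : Measure Ω} {f g : Ω → E} (hf : MemLp f 2 μ)
    (hg : MemLp g 2 μ) : Integrable (fun ω => inner ℝ (f ω) (g ω)) μ := by
  refine ((integrable_norm_sq_of_memLp hf).add (integrable_norm_sq_of_memLp hg)).mono'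
    (hf.1.inner hg.1) (ae_of_all _ fun ω => ?_)
  have := norm_inner_le_norm (𝕜 := ℝ) (f ω) (g ω)
  simp only [Pi.add_apply]
  nlinarith [sq_nonneg (‖f ω‖ - ‖g ω‖), sq_nonneg (‖f ω‖ + ‖g ω‖)]

theorem integral_quadratic_expansion {μ : Measure Ω} {p q r u w : Ω → ℝ} (hp : Integrable p μ)
    (hq : Integrable q μ) (hr : Integrable r μ) (hu : Integrable u μ) (hw : Integrable w μ) :
    ∫ ω, (p ω - 2 * q ω + r ω + 2 * u ω + w ω) ∂μ
      = ∫ ω, p ω ∂μ - 2 * ∫ ω, q ω ∂μ + ∫ ω, r ω ∂μ + 2 * ∫ ω, u ω ∂μ + ∫ ω, w ω ∂μ := by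
  have h1 : Integrable (fun ω => p ω - 2 * q ω) μ := hp.sub (hq.const_mul 2)
  have h2 : Integrable (fun ω => p ω - 2 * q ω + r ω) μ := h1.add hr
  have h3 : Integrable (fun ω => p ω - 2 * q ω + r ω + 2 * u ω) μ := h2.add (hu.const_mul 2)
  rw [integral_add h3 hw, integral_add h2 (hu.const_mul 2), integral_add h1 hr,
    integral_sub hp (hq.const_mul 2), integral_const_mul, integral_const_mul]

/-- A linear stochastic recursion `e (i+1) = e i - D i (e i) + m i` whose increments are, in
conditional mean square, of size `g i`, and whose noise `m i` is conditionally orthogonal to the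
noiseless update. -/
structure IsStochasticRecursion (μ : Measure Ω) (ℱ : Filtration ℕ mΩ) (e : ℕ → Ω → E)
    (D : ℕ → Ω → E →L[ℝ] E) (m : ℕ → Ω → E) (G : ℕ → Ω → ℝ) (g : ℕ → ℝ) (C : ℝ) : Prop where
  e_meas : ∀ i, StronglyMeasurable[ℱ i] (e i)
  D_meas : ∀ i, StronglyMeasurable (D i)
  memLp_zero : MemLp (e 0) 2 μ
  step : ∀ i ω, e (i + 1) ω = e i ω - D i ω (e i ω) + m i ω
  g_nonneg : ∀ i, 0 ≤ g i
  C_nonneg : 0 ≤ C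
  D_bound : ∀ i, ∀ᵐ ω ∂μ, ‖D i ω‖ ^ 2 ≤ g i * G i ω
  G_nonneg : ∀ i ω, 0 ≤ G i ω
  G_integrable : ∀ i, Integrable (G i) μ
  G_condExp : ∀ i, ∀ᵐ ω ∂μ, (μ[G i | ℱ i]) ω ≤ C
  m_memLp : ∀ i, MemLp (e i) 2 μ → MemLp (m i) 2 μ
  m_sq : ∀ i, MemLp (e i) 2 μ → ∀ S, MeasurableSet[ℱ i] S →
    ∫ ω in S, ‖m i ω‖ ^ 2 ∂μ ≤ C * g i * ∫ ω in S, (‖e i ω‖ ^ 2 + 1) ∂μ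
  cross : ∀ i, MemLp (e i) 2 μ → MemLp (fun ω => D i ω (e i ω)) 2 μ → ∀ S, MeasurableSet[ℱ i] S →
    ∫ ω in S, inner ℝ (e i ω - D i ω (e i ω)) (m i ω) ∂μ = 0

namespace IsStochasticRecursion

variable {μ : Measure Ω} [IsFiniteMeasure μ] {ℱ : Filtration ℕ mΩ} {e : ℕ → Ω → E}
  {D : ℕ → Ω → E →L[ℝ] E} {m : ℕ → Ω → E} {G : ℕ → Ω → ℝ} {g : ℕ → ℝ} {C : ℝ}

theorem stronglyMeasurable_apply (hR : IsStochasticRecursion μ ℱ e D m G g C) {f : Ω → E}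
    (hf : StronglyMeasurable f) (i : ℕ) : StronglyMeasurable fun ω => D i ω (f ω) :=
  isBoundedBilinearMap_apply.continuous.comp_stronglyMeasurable ((hR.D_meas i).prodMk hf)

theorem integrable_mul_G (hR : IsStochasticRecursion μ ℱ e D m G g C) {i : ℕ} {X : Ω → ℝ}
    (hX : StronglyMeasurable[ℱ i] X) (hXi : Integrable X μ) (hX0 : ∀ ω, 0 ≤ X ω) :
    Integrable (fun ω => X ω * G i ω) μ :=
  integrable_mul_of_condExp_le (ℱ.le i) hX hXi hX0 (hR.G_integrable i) (hR.G_nonneg i)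
    (hR.G_condExp i)

theorem setIntegral_mul_G_le (hR : IsStochasticRecursion μ ℱ e D m G g C) {i : ℕ} {X : Ω → ℝ}
    (hX : StronglyMeasurable[ℱ i] X) (hXi : Integrable X μ) (hX0 : ∀ ω, 0 ≤ X ω) {S : Set Ω}
    (hS : MeasurableSet[ℱ i] S) :
    ∫ ω in S, X ω * G i ω ∂μ ≤ C * ∫ ω in S, X ω ∂μ :=
  setIntegral_mul_le_of_condExp_le (ℱ.le i) hX hXi hX0 (hR.G_integrable i) (hR.G_nonneg i)
    (hR.G_condExp i) hS

theorem norm_sq_apply_le (hR : IsStochasticRecursion μ ℱ e D m G g C) (i : ℕ) (f : Ω → E) :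
    ∀ᵐ ω ∂μ, ‖D i ω (f ω)‖ ^ 2 ≤ g i * (‖f ω‖ ^ 2 * G i ω) := by
  filter_upwards [hR.D_bound i] with ω h
  calc ‖D i ω (f ω)‖ ^ 2 ≤ (‖D i ω‖ * ‖f ω‖) ^ 2 := by
        gcongr; exact (D i ω).le_opNorm _
    _ = ‖D i ω‖ ^ 2 * ‖f ω‖ ^ 2 := mul_pow _ _ _
    _ ≤ g i * G i ω * ‖f ω‖ ^ 2 := by gcongr
    _ = _ := by ring

theorem memLp_apply (hR : IsStochasticRecursion μ ℱ e D m G g C) {i : ℕ} {f : Ω → E}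
    (hf : StronglyMeasurable[ℱ i] f) (hf2 : MemLp f 2 μ) :
    MemLp (fun ω => D i ω (f ω)) 2 μ := by
  have hm := hR.stronglyMeasurable_apply (hf.mono (ℱ.le i)) i
  rw [memLp_two_iff_integrable_sq_norm hm.aestronglyMeasurable]
  refine ((hR.integrable_mul_G (i := i) (X := fun ω => ‖f ω‖ ^ 2) (hf.norm.pow 2) (integrable_norm_sq_of_memLp hf2)
    (fun ω => by positivity)).const_mul (g i)).mono' (hm.norm.pow 2).aestronglyMeasurable ?_
  filter_upwards [hR.norm_sq_apply_le i f] with ω h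
  rw [Real.norm_of_nonneg (by positivity)]
  exact h

/-- Square integrability propagates along the recursion; this is why the noise fields of the
structure assume it only of the current state. -/
theorem memLp (hR : IsStochasticRecursion μ ℱ e D m G g C) (i : ℕ) : MemLp (e i) 2 μ := by
  induction i with
  | zero => exact hR.memLp_zero
  | succ i ih =>
    have : e (i + 1) = fun ω => e i ω - D i ω (e i ω) + m i ω := funext (hR.step i)
    rw [this]
    exact (ih.sub (hR.memLp_apply (hR.e_meas i) ih)).add (hR.m_memLp i ih)

theorem integrable_norm_sq (hR : IsStochasticRecursion μ ℱ e D m G g C) (i : ℕ) :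
    Integrable (fun ω => ‖e i ω‖ ^ 2) μ :=
  integrable_norm_sq_of_memLp (hR.memLp i)

theorem integrable_norm_sq_add_one (hR : IsStochasticRecursion μ ℱ e D m G g C) (i : ℕ) :
    Integrable (fun ω => ‖e i ω‖ ^ 2 + 1) μ :=
  (hR.integrable_norm_sq i).add (integrable_const _)

theorem setIntegral_norm_sq_le (hR : IsStochasticRecursion μ ℱ e D m G g C) (i : ℕ) (S : Set Ω) :
    ∫ ω in S, ‖e i ω‖ ^ 2 ∂μ ≤ ∫ ω in S, (‖e i ω‖ ^ 2 + 1) ∂μ :=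
  integral_mono (hR.integrable_norm_sq i).integrableOn
    (hR.integrable_norm_sq_add_one i).integrableOn fun ω => by simp

theorem setIntegral_nonneg (e : ℕ → Ω → E) (i : ℕ) (S : Set Ω) :
    0 ≤ ∫ ω in S, (‖e i ω‖ ^ 2 + 1) ∂μ :=
  integral_nonneg fun ω => by positivity

theorem setIntegral_norm_sq_apply_le (hR : IsStochasticRecursion μ ℱ e D m G g C) {i : ℕ}
    {f : Ω → E} (hf : StronglyMeasurable[ℱ i] f) (hf2 : MemLp f 2 μ) {S : Set Ω}
    (hS : MeasurableSet[ℱ i] S) :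
    ∫ ω in S, ‖D i ω (f ω)‖ ^ 2 ∂μ ≤ C * g i * ∫ ω in S, ‖f ω‖ ^ 2 ∂μ := by
  have hfi := integrable_norm_sq_of_memLp hf2
  calc ∫ ω in S, ‖D i ω (f ω)‖ ^ 2 ∂μ ≤ ∫ ω in S, g i * (‖f ω‖ ^ 2 * G i ω) ∂μ :=
        integral_mono_ae (integrable_norm_sq_of_memLp (hR.memLp_apply hf hf2)).integrableOn
          ((hR.integrable_mul_G (X := fun ω => ‖f ω‖ ^ 2) (hf.norm.pow 2) hfi fun ω => by positivity).const_mul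
            (g i)).integrableOn (ae_restrict_of_ae (hR.norm_sq_apply_le i f))
    _ ≤ g i * (C * ∫ ω in S, ‖f ω‖ ^ 2 ∂μ) := by
        rw [integral_const_mul]
        exact mul_le_mul_of_nonneg_left (hR.setIntegral_mul_G_le (X := fun ω => ‖f ω‖ ^ 2) (hf.norm.pow 2) hfi
          (fun ω => by positivity) hS) (hR.g_nonneg i)
    _ = _ := by ring

theorem setIntegral_increment_le (hR : IsStochasticRecursion μ ℱ e D m G g C) (i : ℕ) {S : Set Ω}
    (hS : MeasurableSet[ℱ i] S) :
    ∫ ω in S, ‖e (i + 1) ω - e i ω‖ ^ 2 ∂μ ≤ 4 * C * g i * ∫ ω in S, (‖e i ω‖ ^ 2 + 1) ∂μ := by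
  have hD := integrable_norm_sq_of_memLp (hR.memLp_apply (hR.e_meas i) (hR.memLp i))
  have hm := integrable_norm_sq_of_memLp (hR.m_memLp i (hR.memLp i))
  have h1 : ∫ ω in S, ‖e (i + 1) ω - e i ω‖ ^ 2 ∂μ
      ≤ ∫ ω in S, (2 * ‖D i ω (e i ω)‖ ^ 2 + 2 * ‖m i ω‖ ^ 2) ∂μ := by
    refine integral_mono (integrable_norm_sq_of_memLp
      ((hR.memLp (i + 1)).sub (hR.memLp i))).integrableOn
      ((hD.const_mul 2).add (hm.const_mul 2)).integrableOn fun ω => ?_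
    have : e (i + 1) ω - e i ω = m i ω - D i ω (e i ω) := by rw [hR.step]; abel
    simp only [this]
    nlinarith [norm_sub_le (m i ω) (D i ω (e i ω)), norm_nonneg (m i ω - D i ω (e i ω)),
      sq_nonneg (‖m i ω‖ - ‖D i ω (e i ω)‖), norm_nonneg (m i ω), norm_nonneg (D i ω (e i ω))]
  rw [integral_add (hD.const_mul 2).integrableOn (hm.const_mul 2).integrableOn,
    integral_const_mul, integral_const_mul] at h1
  have h2 := hR.setIntegral_norm_sq_apply_le (hR.e_meas i) (hR.memLp i) hS
  have h3 := hR.m_sq i (hR.memLp i) S hS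
  have h4 := mul_le_mul_of_nonneg_left (hR.setIntegral_norm_sq_le i S)
    (mul_nonneg hR.C_nonneg (hR.g_nonneg i))
  linarith

/-- A crude growth bound, harmless because it is iterated only within one block. The increment
contributes 2 · 4Cg and the previous state contributes 2, so the factor 3 leaves slack. -/
theorem setIntegral_succ_le (hR : IsStochasticRecursion μ ℱ e D m G g C) {g₀ : ℝ}
    (hg₀ : ∀ i, g i ≤ g₀) (i : ℕ) {S : Set Ω} (hS : MeasurableSet[ℱ i] S) :
    ∫ ω in S, (‖e (i + 1) ω‖ ^ 2 + 1) ∂μ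
      ≤ (3 + 8 * C * g₀) * ∫ ω in S, (‖e i ω‖ ^ 2 + 1) ∂μ := by
  have hd : Integrable (fun ω => ‖e (i + 1) ω - e i ω‖ ^ 2) μ :=
    integrable_norm_sq_of_memLp ((hR.memLp (i + 1)).sub (hR.memLp i))
  have h1 : ∫ ω in S, (‖e (i + 1) ω‖ ^ 2 + 1) ∂μ
      ≤ ∫ ω in S, (2 * ‖e (i + 1) ω - e i ω‖ ^ 2 + 2 * (‖e i ω‖ ^ 2 + 1)) ∂μ := by
    refine integral_mono (hR.integrable_norm_sq_add_one _).integrableOn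
      ((hd.const_mul 2).add ((hR.integrable_norm_sq_add_one i).const_mul 2)).integrableOn
      fun ω => ?_
    have := norm_le_norm_sub_add (e (i + 1) ω) (e i ω)
    simp only
    nlinarith [norm_nonneg (e (i + 1) ω), norm_nonneg (e (i + 1) ω - e i ω), norm_nonneg (e i ω),
      sq_nonneg (‖e (i + 1) ω - e i ω‖ - ‖e i ω‖)]
  rw [integral_add (hd.const_mul 2).integrableOn
    ((hR.integrable_norm_sq_add_one i).const_mul 2).integrableOn, integral_const_mul,
    integral_const_mul] at h1
  have h2 := hR.setIntegral_increment_le i hS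
  have h0 := setIntegral_nonneg (μ := μ) e i S
  have h3 : C * g i * ∫ ω in S, (‖e i ω‖ ^ 2 + 1) ∂μ
      ≤ C * g₀ * ∫ ω in S, (‖e i ω‖ ^ 2 + 1) ∂μ := by
    gcongr
    · exact hR.C_nonneg
    · exact hg₀ i
  nlinarith

theorem setIntegral_add_le (hR : IsStochasticRecursion μ ℱ e D m G g C) {g₀ : ℝ}
    (hg₀ : ∀ i, g i ≤ g₀) (s j : ℕ) {S : Set Ω} (hS : MeasurableSet[ℱ s] S) :
    ∫ ω in S, (‖e (s + j) ω‖ ^ 2 + 1) ∂μ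
      ≤ (3 + 8 * C * g₀) ^ j * ∫ ω in S, (‖e s ω‖ ^ 2 + 1) ∂μ := by
  have hg0 : 0 ≤ g₀ := (hR.g_nonneg 0).trans (hg₀ 0)
  have hC := hR.C_nonneg
  induction j with
  | zero => simp
  | succ j ih =>
    calc _ ≤ (3 + 8 * C * g₀) * ∫ ω in S, (‖e (s + j) ω‖ ^ 2 + 1) ∂μ :=
          hR.setIntegral_succ_le hg₀ (s + j) (ℱ.mono (Nat.le_add_right s j) _ hS)
      _ ≤ (3 + 8 * C * g₀) * ((3 + 8 * C * g₀) ^ j * ∫ ω in S, (‖e s ω‖ ^ 2 + 1) ∂μ) := by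
          gcongr
      _ = _ := by ring

/-- Each step has mean-square size O(g), and ‖x + y‖² ≤ 2‖x‖² + 2‖y‖² adds the steps up. The
constant may grow with `j` but is uniform in the starting time `s`, which is what summation over
blocks needs. -/
theorem exists_setIntegral_sub_le (hR : IsStochasticRecursion μ ℱ e D m G g C) {g₀ : ℝ}
    (hg₀ : ∀ i, g i ≤ g₀) (j : ℕ) : ∃ B, 0 ≤ B ∧ ∀ s S, MeasurableSet[ℱ s] S →
      ∫ ω in S, ‖e (s + j) ω - e s ω‖ ^ 2 ∂μ
        ≤ B * (∑ i ∈ Finset.range j, g (s + i)) * ∫ ω in S, (‖e s ω‖ ^ 2 + 1) ∂μ := by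
  have hg0 : 0 ≤ g₀ := (hR.g_nonneg 0).trans (hg₀ 0)
  have hC := hR.C_nonneg
  induction j with
  | zero => exact ⟨0, le_rfl, fun s S _ => by simp⟩
  | succ j ih =>
    obtain ⟨B, hB, ih⟩ := ih
    set K := (3 + 8 * C * g₀) ^ j with hK
    have hK0 : 0 ≤ K := by positivity
    refine ⟨2 * B + 8 * C * K, by positivity, fun s S hS => ?_⟩
    have hd : Integrable (fun ω => ‖e (s + j + 1) ω - e (s + j) ω‖ ^ 2) μ :=
      integrable_norm_sq_of_memLp ((hR.memLp (s + j + 1)).sub (hR.memLp (s + j)))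
    have hd' : Integrable (fun ω => ‖e (s + j) ω - e s ω‖ ^ 2) μ :=
      integrable_norm_sq_of_memLp ((hR.memLp (s + j)).sub (hR.memLp s))
    have h1 : ∫ ω in S, ‖e (s + (j + 1)) ω - e s ω‖ ^ 2 ∂μ
        ≤ ∫ ω in S, (2 * ‖e (s + j + 1) ω - e (s + j) ω‖ ^ 2
          + 2 * ‖e (s + j) ω - e s ω‖ ^ 2) ∂μ := by
      refine integral_mono (integrable_norm_sq_of_memLp
        ((hR.memLp (s + (j + 1))).sub (hR.memLp s))).integrableOn
        ((hd.const_mul 2).add (hd'.const_mul 2)).integrableOn fun ω => ?_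
      have := norm_sub_le_norm_sub_add_norm_sub (e (s + (j + 1)) ω) (e (s + j) ω) (e s ω)
      simp only [← add_assoc] at this ⊢
      nlinarith [norm_nonneg (e (s + j + 1) ω - e s ω),
        sq_nonneg (‖e (s + j + 1) ω - e (s + j) ω‖ - ‖e (s + j) ω - e s ω‖),
        norm_nonneg (e (s + j + 1) ω - e (s + j) ω), norm_nonneg (e (s + j) ω - e s ω)]
    rw [integral_add (hd.const_mul 2).integrableOn (hd'.const_mul 2).integrableOn,
      integral_const_mul, integral_const_mul] at h1
    have h2 := hR.setIntegral_increment_le (s + j) (ℱ.mono (Nat.le_add_right s j) _ hS)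
    have h3 := hR.setIntegral_add_le hg₀ s j hS
    have h4 := ih s S hS
    have hY := setIntegral_nonneg (μ := μ) e s S
    set Y := ∫ ω in S, (‖e s ω‖ ^ 2 + 1) ∂μ
    have hg := hR.g_nonneg (s + j)
    have hsum : 0 ≤ ∑ i ∈ Finset.range j, g (s + i) := Finset.sum_nonneg fun i _ => hR.g_nonneg _
    rw [Finset.sum_range_succ]
    have h5 := mul_le_mul_of_nonneg_left h3 (by positivity : 0 ≤ 4 * C * g (s + j))
    have h6 : 0 ≤ B * g (s + j) * Y := by positivity
    have h7 : 0 ≤ C * K * (∑ i ∈ Finset.range j, g (s + i)) * Y := by positivity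
    nlinarith

/-- Expanding the square, the inner product with the noise integrates to zero; the squared drift and
the squared noise each contribute one multiple of C g. -/
theorem setIntegral_norm_sq_succ_le (hR : IsStochasticRecursion μ ℱ e D m G g C) (i : ℕ)
    {S : Set Ω} (hS : MeasurableSet[ℱ i] S) :
    ∫ ω in S, ‖e (i + 1) ω‖ ^ 2 ∂μ ≤ ∫ ω in S, ‖e i ω‖ ^ 2 ∂μ
      - 2 * ∫ ω in S, inner ℝ (e i ω) (D i ω (e i ω)) ∂μ
      + 2 * C * g i * ∫ ω in S, (‖e i ω‖ ^ 2 + 1) ∂μ := by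
  have he := hR.memLp i
  have hDe := hR.memLp_apply (hR.e_meas i) he
  have hm := hR.m_memLp i he
  have hin := integrable_inner_of_memLp he hDe
  have hcr := integrable_inner_of_memLp (he.sub hDe) hm
  simp only [Pi.sub_apply] at hcr
  have iV := (hR.integrable_norm_sq i).integrableOn (s := S)
  have iD := (integrable_norm_sq_of_memLp hDe).integrableOn (s := S)
  have im := (integrable_norm_sq_of_memLp hm).integrableOn (s := S)
  have h1 : ∫ ω in S, ‖e (i + 1) ω‖ ^ 2 ∂μ = ∫ ω in S, (‖e i ω‖ ^ 2
      - 2 * inner ℝ (e i ω) (D i ω (e i ω)) + ‖D i ω (e i ω)‖ ^ 2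
      + 2 * inner ℝ (e i ω - D i ω (e i ω)) (m i ω) + ‖m i ω‖ ^ 2) ∂μ := by
    congr 1 with ω
    rw [hR.step, norm_add_sq_real, norm_sub_sq_real]
  rw [integral_quadratic_expansion iV hin.integrableOn iD hcr.integrableOn im,
    hR.cross i he hDe S hS] at h1
  have h2 := hR.setIntegral_norm_sq_apply_le (hR.e_meas i) he hS
  have h3 := hR.m_sq i he S hS
  have h4 := mul_le_mul_of_nonneg_left (hR.setIntegral_norm_sq_le i S)
    (mul_nonneg hR.C_nonneg (hR.g_nonneg i))
  rw [h1]
  linarith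

/-- The cost of freezing a quadratic form. With T of order √g and x − y of order √g, every term on
the right is of order g. The split keeps ‖T x‖ and ‖T‖‖y‖ apart, so that in each a second
conditional moment of T suffices. -/
theorem inner_apply_sub_le (T : E →L[ℝ] E) (x y : E) :
    inner ℝ y (T y) - inner ℝ x (T x)
      ≤ 2⁻¹ * ‖x - y‖ ^ 2 + ‖T x‖ ^ 2 + ‖T‖ ^ 2 * ‖y‖ ^ 2 := by
  have h0 : inner ℝ y (T y) - inner ℝ x (T x)
      = - inner ℝ (x - y) (T x) - inner ℝ y (T (x - y)) := by
    simp only [inner_sub_left, inner_sub_right, map_sub]; ring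
  have h1 := (abs_le.1 (abs_real_inner_le_norm (x - y) (T x))).1
  have h2 := (abs_le.1 (abs_real_inner_le_norm y (T (x - y)))).1
  have h3 : ‖y‖ * ‖T (x - y)‖ ≤ ‖y‖ * (‖T‖ * ‖x - y‖) := by gcongr; exact T.le_opNorm _
  nlinarith [sq_nonneg (2⁻¹ * ‖x - y‖ - ‖T x‖), sq_nonneg (2⁻¹ * ‖x - y‖ - ‖T‖ * ‖y‖)]

end IsStochasticRecursion

end Recursion

end DecentralizedRegression

namespace DecentralizedRegression

/-! ### Robbins–Siegmund convergence and deterministic limit lemmas -/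

section AlmostSupermartingale

variable {Ω : Type*} {mΩ : MeasurableSpace Ω} {μ : Measure Ω}

theorem ae_summable_of_summable_integral {f : ℕ → Ω → ℝ} (hf : ∀ k, Integrable (f k) μ)
    (hf0 : ∀ k, 0 ≤ᵐ[μ] f k) (hs : Summable fun k => ∫ ω, f k ω ∂μ) :
    ∀ᵐ ω ∂μ, Summable fun k => f k ω := by
  have h1 : ∫⁻ ω, ∑' k, ENNReal.ofReal (f k ω) ∂μ ≠ ⊤ := by
    rw [lintegral_tsum fun k => (hf k).1.aemeasurable.ennreal_ofReal]
    simp_rw [← fun k => ofReal_integral_eq_lintegral_ofReal (hf k) (hf0 k)]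
    exact hs.tsum_ofReal_ne_top
  have h2 := ae_lt_top' (AEMeasurable.ennreal_tsum fun k =>
    (hf k).1.aemeasurable.ennreal_ofReal) h1
  filter_upwards [h2, ae_all_iff.2 hf0] with ω hω h0
  have := ENNReal.summable_toReal hω.ne
  refine this.congr fun k => ?_
  rw [ENNReal.toReal_ofReal (h0 k)]

/-- An almost supermartingale (Robbins–Siegmund): if
`E[Y (k+1) | 𝒢 k] ≤ (1 + β k) Y k - R k` with `∑ β k < ∞`, then almost surely `Y k` converges and
`∑ R k < ∞`. -/
theorem almostSupermartingale_ae_tendsto [IsFiniteMeasure μ] {𝒢 : Filtration ℕ mΩ}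
    {Y R : ℕ → Ω → ℝ}
    {β : ℕ → ℝ} (hYm : ∀ k, StronglyMeasurable[𝒢 k] (Y k)) (hYi : ∀ k, Integrable (Y k) μ)
    (hY0 : ∀ k ω, 0 ≤ Y k ω) (hRi : ∀ k, Integrable (R k) μ) (hR0 : ∀ k, 0 ≤ᵐ[μ] R k)
    (hβ0 : ∀ k, 0 ≤ β k) (hβ : Summable β)
    (hstep : ∀ k S, MeasurableSet[𝒢 k] S →
      ∫ ω in S, Y (k + 1) ω ∂μ ≤ (1 + β k) * ∫ ω in S, Y k ω ∂μ - ∫ ω in S, R k ω ∂μ) :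
    (∀ᵐ ω ∂μ, ∃ y, Tendsto (fun k => Y k ω) atTop (𝓝 y)) ∧
    (∀ᵐ ω ∂μ, Summable fun k => R k ω) ∧ ∃ B, ∀ k, ∫ ω, Y k ω ∂μ ≤ B := by
  -- Dividing by the partial products of 1 + β turns Y into a genuine supermartingale. Summability
  -- of β keeps these products bounded, so they converge and nothing is lost in passing back to Y.
  set P : ℕ → ℝ := fun k => ∏ j ∈ Finset.range k, (1 + β j) with hP
  have hPpos : ∀ k, 0 < P k := fun k => Finset.prod_pos fun j _ => by linarith [hβ0 j]
  have hPs : ∀ k, P (k + 1) = P k * (1 + β k) := fun k => Finset.prod_range_succ _ _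
  have hPmono : Monotone P := monotone_nat_of_le_succ fun k => by
    rw [hPs]; nlinarith [hPpos k, hβ0 k]
  set B := Real.exp (∑' j, β j) with hB
  have hPB : ∀ k, P k ≤ B := fun k => by
    calc P k ≤ ∏ j ∈ Finset.range k, Real.exp (β j) :=
          Finset.prod_le_prod (fun j _ => by linarith [hβ0 j])
            fun j _ => by linarith [Real.add_one_le_exp (β j)]
      _ = Real.exp (∑ j ∈ Finset.range k, β j) := (Real.exp_sum _ _).symm
      _ ≤ B := Real.exp_le_exp.2 (hβ.sum_le_tsum _ fun j _ => hβ0 j)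
  obtain ⟨p, hp⟩ : ∃ p, Tendsto P atTop (𝓝 p) :=
    ⟨_, tendsto_atTop_ciSup hPmono ⟨B, by rintro _ ⟨k, rfl⟩; exact hPB k⟩⟩
  set W : ℕ → Ω → ℝ := fun k ω => (P k)⁻¹ * Y k ω with hW
  have hWi : ∀ k, Integrable (W k) μ := fun k => (hYi k).const_mul _
  have hW0 : ∀ k ω, 0 ≤ W k ω := fun k ω => mul_nonneg (inv_pos.2 (hPpos k)).le (hY0 k ω)
  have hRS : ∀ k (S : Set Ω), 0 ≤ ∫ ω in S, R k ω ∂μ := fun k S =>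
    integral_nonneg_of_ae (ae_restrict_of_ae (hR0 k))
  have hWstep : ∀ k S, MeasurableSet[𝒢 k] S →
      ∫ ω in S, W (k + 1) ω ∂μ ≤ ∫ ω in S, W k ω ∂μ - (P (k + 1))⁻¹ * ∫ ω in S, R k ω ∂μ := by
    intro k S hS
    simp only [hW, integral_const_mul]
    have h1 := mul_le_mul_of_nonneg_left (hstep k S hS) (inv_pos.2 (hPpos (k + 1))).le
    have h2 : (P (k + 1))⁻¹ * (1 + β k) = (P k)⁻¹ := by
      have := hPpos k
      have h3 : 0 < 1 + β k := by linarith [hβ0 k]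
      rw [hPs]; field_simp
    calc _ ≤ _ := h1
      _ = (P (k + 1))⁻¹ * (1 + β k) * ∫ ω in S, Y k ω ∂μ
          - (P (k + 1))⁻¹ * ∫ ω in S, R k ω ∂μ := by ring
      _ = _ := by rw [h2]
  have hsuper : Supermartingale W 𝒢 μ := by
    refine supermartingale_of_setIntegral_succ_le (fun k => (hYm k).const_mul _) hWi
      fun k S hS => ?_
    have := mul_nonneg (inv_pos.2 (hPpos (k + 1))).le (hRS k S)
    linarith [hWstep k S hS]
  -- Telescoping the expectations: the total discounted decrease is at most the initial value,
  -- because W stays nonnegative.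
  have hWsum : ∀ K, ∑ k ∈ Finset.range K, (P (k + 1))⁻¹ * ∫ ω, R k ω ∂μ
      ≤ ∫ ω, W 0 ω ∂μ - ∫ ω, W K ω ∂μ := by
    intro K
    induction K with
    | zero => simp
    | succ K ih =>
      have := hWstep K Set.univ MeasurableSet.univ
      simp only [Measure.restrict_univ] at this
      rw [Finset.sum_range_succ]
      linarith
  have hRint : ∀ k, 0 ≤ ∫ ω, R k ω ∂μ := fun k => integral_nonneg_of_ae (hR0 k)
  have hWK : ∀ K, ∫ ω, W K ω ∂μ ≤ ∫ ω, W 0 ω ∂μ := fun K => by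
    have : 0 ≤ ∑ k ∈ Finset.range K, (P (k + 1))⁻¹ * ∫ ω, R k ω ∂μ :=
      Finset.sum_nonneg fun k _ => mul_nonneg (inv_pos.2 (hPpos _)).le (hRint k)
    linarith [hWsum K]
  refine ⟨?_, ?_, ?_⟩
  -- The negative of W is an L¹-bounded submartingale, so Doob's theorem applies; multiplying by the
  -- convergent P recovers Y.
  · have hbdd : ∀ k, eLpNorm ((-W) k) 1 μ ≤ (∫ ω, W 0 ω ∂μ).toNNReal := by
      intro k
      rw [Pi.neg_apply, eLpNorm_neg, eLpNorm_one_eq_lintegral_enorm]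
      have : ∀ ω, ‖W k ω‖ₑ = ENNReal.ofReal (W k ω) := fun ω => by
        rw [Real.enorm_of_nonneg (hW0 k ω)]
      simp_rw [this]
      rw [← ofReal_integral_eq_lintegral_ofReal (hWi k) (ae_of_all _ (hW0 k))]
      exact ENNReal.ofReal_le_ofReal (hWK k)
    filter_upwards [hsuper.neg.ae_tendsto_limitProcess hbdd] with ω hω
    refine ⟨_, (hp.mul hω.neg).congr fun k => ?_⟩
    have := (hPpos k).ne'
    simp [hW]; field_simp
  · refine ae_summable_of_summable_integral hRi hR0 ?_
    refine summable_of_sum_range_le (c := B * ∫ ω, W 0 ω ∂μ) hRint fun K => ?_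
    calc ∑ k ∈ Finset.range K, ∫ ω, R k ω ∂μ
        ≤ ∑ k ∈ Finset.range K, B * ((P (k + 1))⁻¹ * ∫ ω, R k ω ∂μ) := by
          refine Finset.sum_le_sum fun k _ => ?_
          rw [← mul_assoc]
          refine le_mul_of_one_le_left (hRint k) ?_
          rw [← div_eq_mul_inv, one_le_div (hPpos _)]
          exact hPB _
      _ ≤ _ := by
          rw [← Finset.mul_sum]
          refine mul_le_mul_of_nonneg_left ?_ (Real.exp_pos _).le
          linarith [hWsum K, integral_nonneg (μ := μ) (f := W K) (hW0 K)]
  · refine ⟨B * ∫ ω, W 0 ω ∂μ, fun k => ?_⟩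
    have h1 : ∫ ω, Y k ω ∂μ = P k * ∫ ω, W k ω ∂μ := by
      simp only [hW, integral_const_mul]
      rw [mul_inv_cancel_left₀ (hPpos k).ne']
    rw [h1]
    exact mul_le_mul (hPB k) (hWK k) (integral_nonneg (hW0 k)) (Real.exp_pos _).le

/-- If the limit y were positive, then V > y/2 eventually, hence L ≤ (2/y)R eventually and L would
be summable. -/
theorem tendsto_zero_of_summable_mul {L V R : ℕ → ℝ} {y : ℝ} (hL : ∀ k, 0 ≤ L k)
    (hLsum : Tendsto (fun K => ∑ k ∈ Finset.range K, L k) atTop atTop) (hV : ∀ k, 0 ≤ V k)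
    (hVy : Tendsto V atTop (𝓝 y)) (hLV : ∀ k, L k * V k ≤ R k) (hR : Summable R) :
    Tendsto V atTop (𝓝 0) := by
  rcases (ge_of_tendsto' hVy hV).eq_or_lt with h0 | hy
  · rwa [h0]
  exfalso
  have hev : ∀ᶠ k in atTop, y / 2 < V k := hVy.eventually_const_lt (half_lt_self hy)
  have hLs : Summable L := by
    refine (hR.mul_left (2 / y)).of_norm_bounded_eventually_nat ?_
    filter_upwards [hev] with k hk
    rw [Real.norm_of_nonneg (hL k), div_mul_eq_mul_div, le_div_iff₀ hy]
    nlinarith [hLV k, hL k, mul_le_mul_of_nonneg_left hk.le (hL k)]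
  exact not_tendsto_atTop_of_tendsto_nhds hLs.hasSum.tendsto_sum_nat hLsum

theorem tendsto_of_tendsto_residues {X : Type*} {f : ℕ → X} {l : Filter X} {h : ℕ} (hh : 0 < h)
    (hf : ∀ j < h, Tendsto (fun k => f (k * h + j)) atTop l) : Tendsto f atTop l := by
  intro s hs
  have h1 : ∀ᶠ k in atTop, ∀ j ∈ Finset.range h, f (k * h + j) ∈ s :=
    (Finset.eventually_all _).2 fun j hj => hf j (Finset.mem_range.1 hj) hs
  obtain ⟨K, hK⟩ := eventually_atTop.1 h1
  refine mem_atTop_sets.2 ⟨K * h, fun k hk => ?_⟩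
  have := hK (k / h) ((Nat.le_div_iff_mul_le hh).2 hk) (k % h)
    (Finset.mem_range.2 (Nat.mod_lt _ hh))
  rwa [Nat.div_add_mod'] at this

end AlmostSupermartingale

/-! ### Block estimates and almost sure convergence of the recursion -/

namespace IsStochasticRecursion

variable {Ω E : Type*} {mΩ : MeasurableSpace Ω} [NormedAddCommGroup E] [InnerProductSpace ℝ E]
variable {μ : Measure Ω} [IsFiniteMeasure μ] {ℱ : Filtration ℕ mΩ} {e : ℕ → Ω → E}
  {D : ℕ → Ω → E →L[ℝ] E} {m : ℕ → Ω → E} {G : ℕ → Ω → ℝ} {g : ℕ → ℝ} {C : ℝ}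

theorem memLp_apply_of_le (hR : IsStochasticRecursion μ ℱ e D m G g C) (s j : ℕ) :
    MemLp (fun ω => D (s + j) ω (e s ω)) 2 μ :=
  hR.memLp_apply ((hR.e_meas s).mono (ℱ.mono (Nat.le_add_right s j))) (hR.memLp s)

/-- The freezing inequality, integrated. Both `e s` and `e (s + j)` are known before the operator at
time s + j acts, so its conditional second moment bounds both error terms. -/
theorem setIntegral_inner_sub_le (hR : IsStochasticRecursion μ ℱ e D m G g C) (s j : ℕ)
    {S : Set Ω} (hS : MeasurableSet[ℱ s] S) :
    ∫ ω in S, inner ℝ (e s ω) (D (s + j) ω (e s ω)) ∂μ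
        - ∫ ω in S, inner ℝ (e (s + j) ω) (D (s + j) ω (e (s + j) ω)) ∂μ
      ≤ 2⁻¹ * ∫ ω in S, ‖e (s + j) ω - e s ω‖ ^ 2 ∂μ
        + C * g (s + j) * ∫ ω in S, (‖e (s + j) ω‖ ^ 2 + 1) ∂μ
        + C * g (s + j) * ∫ ω in S, (‖e s ω‖ ^ 2 + 1) ∂μ := by
  set i := s + j with hi
  have hle : ℱ s ≤ ℱ i := ℱ.mono (Nat.le_add_right s j)
  have hs := hR.memLp s
  have he := hR.memLp i
  have hDe := hR.memLp_apply (hR.e_meas i) he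
  have hsm := (hR.e_meas s).mono hle
  have hDs := hR.memLp_apply hsm hs
  have i1 := (integrable_inner_of_memLp hs hDs).integrableOn (s := S)
  have i2 := (integrable_inner_of_memLp he hDe).integrableOn (s := S)
  have i3 : IntegrableOn (fun ω => ‖e i ω - e s ω‖ ^ 2) S μ :=
    (integrable_norm_sq_of_memLp (he.sub hs)).integrableOn
  have i4 : IntegrableOn (fun ω => ‖D i ω (e i ω)‖ ^ 2) S μ :=
    (integrable_norm_sq_of_memLp hDe).integrableOn
  have i5 : IntegrableOn (fun ω => g i * (‖e s ω‖ ^ 2 * G i ω)) S μ :=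
    ((hR.integrable_mul_G (X := fun ω => ‖e s ω‖ ^ 2) (hsm.norm.pow 2) (hR.integrable_norm_sq s)
      fun ω => by positivity).const_mul (g i)).integrableOn
  have h34 : IntegrableOn (fun ω => 2⁻¹ * ‖e i ω - e s ω‖ ^ 2 + ‖D i ω (e i ω)‖ ^ 2) S μ :=
    (i3.const_mul 2⁻¹).add i4
  have h1 : ∫ ω in S, inner ℝ (e s ω) (D i ω (e s ω)) ∂μ
        - ∫ ω in S, inner ℝ (e i ω) (D i ω (e i ω)) ∂μ
      ≤ ∫ ω in S, (2⁻¹ * ‖e i ω - e s ω‖ ^ 2 + ‖D i ω (e i ω)‖ ^ 2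
        + g i * (‖e s ω‖ ^ 2 * G i ω)) ∂μ := by
    rw [← integral_sub i1 i2]
    refine integral_mono_ae (i1.sub i2) (h34.add i5) (ae_restrict_of_ae ?_)
    filter_upwards [hR.D_bound i] with ω hω
    have h2 := inner_apply_sub_le (D i ω) (e i ω) (e s ω)
    have h3 := mul_le_mul_of_nonneg_right hω (sq_nonneg ‖e s ω‖)
    linarith
  rw [integral_add h34 i5, integral_add (i3.const_mul 2⁻¹) i4, integral_const_mul,
    integral_const_mul] at h1
  have hCg := mul_nonneg hR.C_nonneg (hR.g_nonneg i)
  have h2 := hR.setIntegral_norm_sq_apply_le (hR.e_meas i) he (hle _ hS)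
  have h3 := mul_le_mul_of_nonneg_left (hR.setIntegral_mul_G_le (i := i)
    (X := fun ω => ‖e s ω‖ ^ 2) (hsm.norm.pow 2) (hR.integrable_norm_sq s)
      (fun ω => by positivity) (hle _ hS)) (hR.g_nonneg i)
  have h4 := mul_le_mul_of_nonneg_left (hR.setIntegral_norm_sq_le i S) hCg
  have h5 := mul_le_mul_of_nonneg_left (hR.setIntegral_norm_sq_le s S) hCg
  linarith

theorem exists_setIntegral_block_le (hR : IsStochasticRecursion μ ℱ e D m G g C) {g₀ : ℝ}
    (hg₀ : ∀ i, g i ≤ g₀) (j : ℕ) : ∃ B, 0 ≤ B ∧ ∀ s S, MeasurableSet[ℱ s] S →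
      ∫ ω in S, ‖e (s + j) ω‖ ^ 2 ∂μ ≤ ∫ ω in S, ‖e s ω‖ ^ 2 ∂μ
        - 2 * ∑ l ∈ Finset.range j, ∫ ω in S, inner ℝ (e s ω) (D (s + l) ω (e s ω)) ∂μ
        + B * (∑ l ∈ Finset.range j, g (s + l)) * ∫ ω in S, (‖e s ω‖ ^ 2 + 1) ∂μ := by
  have hg0 : 0 ≤ g₀ := (hR.g_nonneg 0).trans (hg₀ 0)
  have hC := hR.C_nonneg
  induction j with
  | zero => exact ⟨0, le_rfl, fun s S _ => by simp⟩
  | succ j ih =>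
    obtain ⟨B, hB, ih⟩ := ih
    obtain ⟨B', hB', hsub⟩ := hR.exists_setIntegral_sub_le hg₀ j
    set K := (3 + 8 * C * g₀) ^ j with hK
    have hK0 : 0 ≤ K := by positivity
    -- B comes from the previous steps and B' from the displacement since the block start. The term
    -- 4CK combines 2CK from the one-step estimate with 2CK from freezing at the current state; 2C
    -- comes from freezing at the block start.
    refine ⟨B + B' + 4 * C * K + 2 * C, by positivity, fun s S hS => ?_⟩
    have h1 := hR.setIntegral_norm_sq_succ_le (s + j) (ℱ.mono (Nat.le_add_right s j) _ hS)
    have h2 := hR.setIntegral_inner_sub_le s j hS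
    have h3 := hR.setIntegral_add_le hg₀ s j hS
    have h4 := ih s S hS
    have h5 := hsub s S hS
    have hY := setIntegral_nonneg (μ := μ) e s S
    have hg := hR.g_nonneg (s + j)
    have hsum : 0 ≤ ∑ i ∈ Finset.range j, g (s + i) := Finset.sum_nonneg fun i _ => hR.g_nonneg _
    rw [Finset.sum_range_succ, Finset.sum_range_succ, ← add_assoc s j 1]
    set Y := ∫ ω in S, (‖e s ω‖ ^ 2 + 1) ∂μ
    have h6 := mul_le_mul_of_nonneg_left h3 (by positivity : 0 ≤ 4 * C * g (s + j))
    have h7 : 0 ≤ (B + B') * g (s + j) * Y := by positivity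
    have h8 : 0 ≤ (4 * C * K + 2 * C) * (∑ i ∈ Finset.range j, g (s + i)) * Y := by positivity
    rw [← hK] at h6
    linarith

/-- The hypothesis `hL` is the only contraction required: a lower bound for the conditional frozen
form over a whole block, seen from its start. -/
theorem ae_tendsto_zero (hR : IsStochasticRecursion μ ℱ e D m G g C) (hg : Summable g) {h : ℕ}
    (hh : 0 < h) {L : ℕ → Ω → ℝ} (hL0 : ∀ᵐ ω ∂μ, ∀ k, 0 ≤ L k ω)
    (hLsum : ∀ᵐ ω ∂μ, Tendsto (fun K => ∑ k ∈ Finset.range K, L k ω) atTop atTop)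
    (hL : ∀ k, ∀ᵐ ω ∂μ, L k ω * ‖e (k * h) ω‖ ^ 2 ≤
      (μ[fun ω => ∑ l ∈ Finset.range h, inner ℝ (e (k * h) ω) (D (k * h + l) ω (e (k * h) ω))
        | ℱ (k * h)]) ω) :
    ∀ᵐ ω ∂μ, Tendsto (fun k => e k ω) atTop (𝓝 0) := by
  have hg₀ : ∀ i, g i ≤ ∑' i, g i := fun i => hg.le_tsum i fun j _ => hR.g_nonneg j
  obtain ⟨B, hB0, hB⟩ := hR.exists_setIntegral_block_le hg₀ h
  set Q : ℕ → Ω → ℝ := fun k ω =>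
    ∑ l ∈ Finset.range h, inner ℝ (e (k * h) ω) (D (k * h + l) ω (e (k * h) ω)) with hQ
  have hQl : ∀ k l, Integrable
      (fun ω => inner ℝ (e (k * h) ω) (D (k * h + l) ω (e (k * h) ω))) μ := fun k l =>
    integrable_inner_of_memLp (hR.memLp _) (hR.memLp_apply_of_le _ _)
  have hQi : ∀ k, Integrable (Q k) μ := fun k => integrable_finsetSum _ fun l _ => hQl k l
  have hmono : Monotone fun k => ℱ (k * h) := fun i j hij =>
    ℱ.mono (Nat.mul_le_mul_right h hij)
  let 𝒢 : Filtration ℕ mΩ := ⟨fun k => ℱ (k * h), hmono, fun k => ℱ.le _⟩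
  have hγ : ∀ j, Summable fun k => ∑ l ∈ Finset.range j, g (k * h + l) := fun j =>
    summable_sum fun l _ => hg.comp_injective fun a b hab =>
      Nat.eq_of_mul_eq_mul_right hh (Nat.add_right_cancel hab)
  have hγ0 : ∀ j k, 0 ≤ ∑ l ∈ Finset.range j, g (k * h + l) := fun j k =>
    Finset.sum_nonneg fun l _ => hR.g_nonneg _
  obtain ⟨hconv, hRs, M, hM⟩ := almostSupermartingale_ae_tendsto (μ := μ) (𝒢 := 𝒢)
    -- The error in the block estimate is proportional to ‖e‖² + 1. Adding 1 to the energy absorbs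
    -- its additive part into the factor 1 + β, as the almost supermartingale lemma has no additive
    -- term.
    (Y := fun k ω => ‖e (k * h) ω‖ ^ 2 + 1) (R := fun k ω => 2 * (μ[Q k | ℱ (k * h)]) ω)
    (β := fun k => B * ∑ l ∈ Finset.range h, g (k * h + l))
    (fun k => ((hR.e_meas (k * h)).norm.pow 2).add stronglyMeasurable_const)
    (fun k => hR.integrable_norm_sq_add_one _) (fun k ω => by positivity)
    (fun k => integrable_condExp.const_mul 2)
    (fun k => by
      filter_upwards [hL k, hL0] with ω h1 h2
      have := mul_nonneg (h2 k) (sq_nonneg ‖e (k * h) ω‖)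
      simp only [Pi.zero_apply]
      linarith)
    (fun k => mul_nonneg hB0 (hγ0 h k)) ((hγ h).mul_left B)
    (fun k S hS => by
      have h1 := hB (k * h) S hS
      have h2 : ∀ i, ∫ ω in S, (‖e i ω‖ ^ 2 + 1) ∂μ
          = ∫ ω in S, ‖e i ω‖ ^ 2 ∂μ + ∫ ω in S, (1 : ℝ) ∂μ := fun i =>
        integral_add (hR.integrable_norm_sq i).integrableOn (integrable_const _)
      rw [integral_const_mul, setIntegral_condExp (ℱ.le _) (hQi k) hS,
        integral_finsetSum _ fun l _ => (hQl k l).integrableOn, add_mul, add_mul, one_mul, one_mul,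
        h2 (k * h + h)]
      rw [h2 (k * h)] at h1 ⊢
      linarith)
  -- The expectations of Y are bounded, so the expected squared displacements from block starts are
  -- dominated by a summable series in g.
  have hsubs : ∀ j, ∀ᵐ ω ∂μ, Summable fun k => ‖e (k * h + j) ω - e (k * h) ω‖ ^ 2 := by
    intro j
    obtain ⟨B', hB'0, hB'⟩ := hR.exists_setIntegral_sub_le hg₀ j
    have hi : ∀ k, Integrable (fun ω => ‖e (k * h + j) ω - e (k * h) ω‖ ^ 2) μ := fun k =>
      integrable_norm_sq_of_memLp ((hR.memLp _).sub (hR.memLp _))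
    refine ae_summable_of_summable_integral hi (fun k => ae_of_all _ fun ω => by positivity) ?_
    refine Summable.of_nonneg_of_le (fun k => integral_nonneg fun ω => by positivity)
      (fun k => ?_) (((hγ j).mul_left B').mul_right M)
    have h1 := hB' (k * h) Set.univ MeasurableSet.univ
    simp only [Measure.restrict_univ] at h1
    exact h1.trans (mul_le_mul_of_nonneg_left (hM k) (mul_nonneg hB'0 (hγ0 j k)))
  filter_upwards [hconv, hRs, ae_all_iff.2 hsubs, hL0, hLsum, ae_all_iff.2 hL]
    with ω ⟨y, hy⟩ h2 h3 h4 h5 h6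
  have hV : Tendsto (fun k => ‖e (k * h) ω‖ ^ 2) atTop (𝓝 0) := by
    refine tendsto_zero_of_summable_mul h4 h5 (fun k => by positivity)
      (y := y - 1) ?_ h6 ?_
    · simpa using hy.sub_const 1
    · simpa using h2.mul_left (2⁻¹ : ℝ)
  have hsq : ∀ u : ℕ → E, Tendsto (fun k => ‖u k‖ ^ 2) atTop (𝓝 0) → Tendsto u atTop (𝓝 0) := by
    intro u hu
    rw [tendsto_zero_iff_norm_tendsto_zero]
    simpa using hu.sqrt
  refine tendsto_of_tendsto_residues hh fun j _ => ?_
  simpa using (hsq _ (h3 j).tendsto_atTop_zero).add (hsq _ hV)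

end IsStochasticRecursion

end DecentralizedRegression

noncomputable section
namespace DecentralizedRegression

/-! ### Stacked vectors and spectral norms -/

section Stacking

variable {N n : ℕ}

/-- The vector obtained by stacking the vectors `x i`. -/
def stack (x : Fin N → EuclideanSpace ℝ (Fin n)) : EuclideanSpace ℝ (Fin N × Fin n) :=
  WithLp.toLp 2 fun p => x p.1 p.2

theorem stack_apply (x : Fin N → EuclideanSpace ℝ (Fin n)) (p : Fin N × Fin n) :
    stack x p = x p.1 p.2 := rfl

/-- The `i`-th block of a stacked vector. -/
def block (z : EuclideanSpace ℝ (Fin N × Fin n)) (i : Fin N) : EuclideanSpace ℝ (Fin n) :=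
  WithLp.toLp 2 fun c => z (i, c)

theorem norm_sq_stack (x : Fin N → EuclideanSpace ℝ (Fin n)) :
    ‖stack x‖ ^ 2 = ∑ i, ‖x i‖ ^ 2 := by
  simp [EuclideanSpace.real_norm_sq_eq, stack_apply, Fintype.sum_prod_type]

theorem norm_le_norm_stack (x : Fin N → EuclideanSpace ℝ (Fin n)) (i : Fin N) :
    ‖x i‖ ≤ ‖stack x‖ := by
  refine le_of_sq_le_sq ?_ (norm_nonneg _)
  rw [norm_sq_stack]
  exact Finset.single_le_sum (f := fun i => ‖x i‖ ^ 2) (fun j _ => by positivity)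
    (Finset.mem_univ i)

theorem norm_block_le (z : EuclideanSpace ℝ (Fin N × Fin n)) (i : Fin N) :
    ‖block z i‖ ≤ ‖z‖ := norm_le_norm_stack (block z) i

theorem inner_stack (z : EuclideanSpace ℝ (Fin N × Fin n))
    (y : Fin N → EuclideanSpace ℝ (Fin n)) :
    inner ℝ z (stack y) = ∑ i, inner ℝ (block z i) (y i) := by
  simp [PiLp.inner_apply, stack_apply, Fintype.sum_prod_type, block]

end Stacking

section MatrixNorms

variable {ι κ : Type*} [Fintype ι] [Fintype κ] [DecidableEq ι] [DecidableEq κ]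

theorem norm_toEuclideanLin_le (B : Matrix ι κ ℝ) (x : EuclideanSpace ℝ κ) :
    ‖Matrix.toEuclideanLin B x‖ ≤ ‖B‖ * ‖x‖ :=
  B.l2_opNorm_mulVec x

theorem l2_opNorm_le_of_forall (B : Matrix ι κ ℝ) {c : ℝ} (hc : 0 ≤ c)
    (h : ∀ x, ‖Matrix.toEuclideanLin B x‖ ≤ c * ‖x‖) : ‖B‖ ≤ c := by
  rw [Matrix.l2_opNorm_def]
  exact ContinuousLinearMap.opNorm_le_bound _ hc h

theorem abs_entry_le_l2_opNorm (B : Matrix ι κ ℝ) (i : ι) (j : κ) : |B i j| ≤ ‖B‖ := by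
  have h1 := norm_toEuclideanLin_le B (EuclideanSpace.single j 1)
  have h2 := PiLp.norm_apply_le (Matrix.toEuclideanLin B (EuclideanSpace.single j 1)) i
  rw [show ‖EuclideanSpace.single j (1 : ℝ)‖ = 1 by simp, mul_one] at h1
  refine le_trans (le_of_eq ?_) (h2.trans h1)
  simp [Matrix.toEuclideanLin]

theorem inner_toEuclideanLin_transpose (B : Matrix ι κ ℝ) (x : EuclideanSpace ℝ κ)
    (y : EuclideanSpace ℝ ι) :
    inner ℝ x (Matrix.toEuclideanLin B.transpose y) = inner ℝ (Matrix.toEuclideanLin B x) y := by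
  rw [← Matrix.conjTranspose_eq_transpose_of_trivial, Matrix.toEuclideanLin_conjTranspose_eq_adjoint,
    LinearMap.adjoint_inner_right]

/-- From the C*-identity ‖BᵀB‖ = ‖B‖². It lets moment bounds on the Gram matrix control the
observation noise Hᵀv. -/
theorem norm_transpose_toEuclideanLin_sq_le (B : Matrix ι κ ℝ) (x : EuclideanSpace ℝ ι) :
    ‖Matrix.toEuclideanLin B.transpose x‖ ^ 2 ≤ ‖B.transpose * B‖ * ‖x‖ ^ 2 := by
  have h1 := norm_toEuclideanLin_le B.transpose x
  have h2 : ‖B.transpose‖ = ‖B‖ := by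
    rw [← Matrix.conjTranspose_eq_transpose_of_trivial, Matrix.l2_opNorm_conjTranspose]
  have h3 : ‖B.transpose * B‖ = ‖B‖ * ‖B‖ := by
    rw [← Matrix.conjTranspose_eq_transpose_of_trivial, Matrix.l2_opNorm_conjTranspose_mul_self]
  rw [h2] at h1
  rw [h3]
  calc _ ≤ (‖B‖ * ‖x‖) ^ 2 := by gcongr
    _ = _ := by ring

variable {N n : ℕ}

theorem toEuclideanCLM_kronecker_one_stack (B : Matrix (Fin N) (Fin N) ℝ)
    (x : Fin N → EuclideanSpace ℝ (Fin n)) :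
    Matrix.toEuclideanCLM (𝕜 := ℝ) (B ⊗ₖ (1 : Matrix (Fin n) (Fin n) ℝ)) (stack x)
      = stack fun i => ∑ j, B i j • x j := by
  ext p
  simp [Matrix.mulVec, dotProduct, Fintype.sum_prod_type, Matrix.kroneckerMap_apply,
    Matrix.one_apply, stack]

/-- The Kronecker product applies `B` separately to each of the n coordinate slices, and the squared
norm is the sum over slices. -/
theorem l2_opNorm_kronecker_one_le (B : Matrix (Fin N) (Fin N) ℝ) :
    ‖B ⊗ₖ (1 : Matrix (Fin n) (Fin n) ℝ)‖ ≤ ‖B‖ := by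
  refine l2_opNorm_le_of_forall _ (norm_nonneg _) fun z => ?_
  refine le_of_sq_le_sq ?_ (by positivity)
  have h1 : Matrix.toEuclideanLin (B ⊗ₖ (1 : Matrix (Fin n) (Fin n) ℝ)) z
      = stack fun i => ∑ j, B i j • block z j :=
    toEuclideanCLM_kronecker_one_stack B (block z)
  have h2 : ∀ c : Fin n, ∑ i, (∑ j, B i j * z (j, c)) ^ 2 ≤ ‖B‖ ^ 2 * ∑ i, z (i, c) ^ 2 := by
    intro c
    have h3 := norm_toEuclideanLin_le B (WithLp.toLp 2 fun j => z (j, c))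
    have h4 : ‖Matrix.toEuclideanLin B (WithLp.toLp 2 fun j => z (j, c))‖ ^ 2
        ≤ (‖B‖ * ‖WithLp.toLp 2 fun j => z (j, c)‖) ^ 2 := by gcongr
    rw [mul_pow, EuclideanSpace.real_norm_sq_eq, EuclideanSpace.real_norm_sq_eq] at h4
    exact h4
  rw [h1, mul_pow, EuclideanSpace.real_norm_sq_eq, EuclideanSpace.real_norm_sq_eq,
    Fintype.sum_prod_type_right, Fintype.sum_prod_type_right, Finset.mul_sum]
  refine Finset.sum_le_sum fun c _ => le_trans (le_of_eq ?_) (h2 c)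
  simp [stack_apply, block]

end MatrixNorms

/-! ### The error recursion of the algorithm -/

namespace Model

variable {Ω : Type*} [MeasurableSpace Ω] {N n : ℕ} {d : Fin N → ℕ} (M : Model Ω N n d)

theorem gram_apply (k : ℕ) (ω : Ω) (p q : Fin N × Fin n) :
    M.gram k ω p q = if p.1 = q.1 then ∑ r, M.H q.1 k ω r p.2 * M.H q.1 k ω r q.2 else 0 := by
  simp only [gram, Matrix.mul_apply, Matrix.transpose_apply, blockH, Matrix.of_apply,
    Fintype.sum_sigma]
  rw [Finset.sum_eq_single q.1]
  · by_cases h : p.1 = q.1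
    · simp [h]
    · simp [h, Ne.symm h]
  · intro i _ hi
    simp [hi]
  · simp

theorem toEuclideanCLM_gram_stack (k : ℕ) (ω : Ω) (x : Fin N → EuclideanSpace ℝ (Fin n)) :
    Matrix.toEuclideanCLM (𝕜 := ℝ) (M.gram k ω) (stack x) = stack fun i =>
      Matrix.toEuclideanLin (M.H i k ω).transpose (Matrix.toEuclideanLin (M.H i k ω) (x i)) := by
  ext ⟨i, c⟩
  simp only [Matrix.ofLp_toEuclideanCLM, Matrix.mulVec, dotProduct, Fintype.sum_prod_type,
    gram_apply, stack_apply, Matrix.ofLp_toLpLin, Matrix.toLin'_apply, Matrix.transpose_apply, ite_mul,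
    zero_mul, Finset.mul_sum, Finset.sum_mul]
  rw [Finset.sum_comm' (t' := Finset.univ) (s' := fun _ => Finset.univ) (by simp)]
  simp only [Finset.sum_ite_eq, Finset.mem_univ, if_true]
  rw [Finset.sum_comm]
  simp [mul_assoc]

theorem norm_gram_block_le (k : ℕ) (ω : Ω) (i : Fin N) :
    ‖(M.H i k ω).transpose * M.H i k ω‖ ≤ ‖M.gram k ω‖ := by
  refine l2_opNorm_le_of_forall _ (norm_nonneg _) fun y => ?_
  have h1 := (Matrix.toEuclideanCLM (𝕜 := ℝ) (M.gram k ω)).le_opNorm (stack (Pi.single i y))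
  rw [Matrix.l2_opNorm_toEuclideanCLM, toEuclideanCLM_gram_stack] at h1
  have h2 : ‖stack (Pi.single i y)‖ = ‖y‖ := by
    rw [← sq_eq_sq₀ (norm_nonneg _) (norm_nonneg _), norm_sq_stack,
      Finset.sum_eq_single i (fun j _ hj => by simp [hj]) (by simp)]
    simp
  rw [h2] at h1
  refine le_trans (le_of_eq ?_) ((norm_le_norm_stack _ i).trans h1)
  simp [Matrix.toEuclideanLin, Matrix.toLpLin, Matrix.toLin'_apply, Matrix.mulVec_mulVec]

theorem norm_transpose_H_sq_le (k : ℕ) (ω : Ω) (i : Fin N) (x : EuclideanSpace ℝ (Fin (d i))) :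
    ‖Matrix.toEuclideanLin (M.H i k ω).transpose x‖ ^ 2 ≤ ‖M.gram k ω‖ * ‖x‖ ^ 2 :=
  (norm_transpose_toEuclideanLin_sq_le _ x).trans
    (mul_le_mul_of_nonneg_right (M.norm_gram_block_le k ω i) (by positivity))

theorem abs_A_le (k : ℕ) (ω : Ω) (i j : Fin N) : |M.A k ω i j| ≤ ‖M.laplacian k ω‖ := by
  by_cases h : i = j
  · subst h; simp [M.A_diag]
  · have := abs_entry_le_l2_opNorm (M.laplacian k ω) i j
    simpa [laplacian, Matrix.diagonal_apply_ne _ h] using this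

/-- The matrix `b(k) 𝓛(k) ⊗ I + a(k) 𝓗ᵀ(k) 𝓗(k)` driving the estimation error. -/
def drift (a b : ℕ → ℝ) (k : ℕ) (ω : Ω) : Matrix (Fin N × Fin n) (Fin N × Fin n) ℝ :=
  b k • (M.laplacian k ω ⊗ₖ (1 : Matrix (Fin n) (Fin n) ℝ)) + a k • M.gram k ω

/-- The drift matrix with the symmetrized Laplacian. -/
def symDrift (a b : ℕ → ℝ) (k : ℕ) (ω : Ω) : Matrix (Fin N × Fin n) (Fin N × Fin n) ℝ :=
  b k • (M.symLaplacian k ω ⊗ₖ (1 : Matrix (Fin n) (Fin n) ℝ)) + a k • M.gram k ω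

theorem norm_drift_sq_le (a b : ℕ → ℝ) (k : ℕ) (ω : Ω) :
    ‖M.drift a b k ω‖ ^ 2
      ≤ (a k ^ 2 + b k ^ 2) * (‖M.laplacian k ω‖ ^ 2 + ‖M.gram k ω‖ ^ 2) := by
  have h1 : ‖M.drift a b k ω‖ ≤ |b k| * ‖M.laplacian k ω‖ + |a k| * ‖M.gram k ω‖ := by
    refine (norm_add_le _ _).trans ?_
    rw [norm_smul, norm_smul, Real.norm_eq_abs, Real.norm_eq_abs]
    gcongr
    exact l2_opNorm_kronecker_one_le _
  calc _ ≤ (|b k| * ‖M.laplacian k ω‖ + |a k| * ‖M.gram k ω‖) ^ 2 := by gcongr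
    _ ≤ (|a k| ^ 2 + |b k| ^ 2) * (‖M.laplacian k ω‖ ^ 2 + ‖M.gram k ω‖ ^ 2) := by
        nlinarith [sq_nonneg (|b k| * ‖M.gram k ω‖ - |a k| * ‖M.laplacian k ω‖)]
    _ = _ := by simp only [sq_abs]

/-- A real quadratic form sees only the symmetric part of its matrix. This is how the symmetrized
Laplacian enters, although the dynamics use the Laplacian itself. -/
theorem inner_drift_eq_inner_symDrift (a b : ℕ → ℝ) (k : ℕ) (ω : Ω)
    (x : EuclideanSpace ℝ (Fin N × Fin n)) :
    inner ℝ x (Matrix.toEuclideanCLM (𝕜 := ℝ) (M.drift a b k ω) x)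
      = inner ℝ x (Matrix.toEuclideanCLM (𝕜 := ℝ) (M.symDrift a b k ω) x) := by
  have key : ∀ B : Matrix (Fin N) (Fin N) ℝ,
      x.ofLp ⬝ᵥ (B.transpose ⊗ₖ (1 : Matrix (Fin n) (Fin n) ℝ)).mulVec x.ofLp
        = x.ofLp ⬝ᵥ (B ⊗ₖ (1 : Matrix (Fin n) (Fin n) ℝ)).mulVec x.ofLp := by
    intro B
    have : B.transpose ⊗ₖ (1 : Matrix (Fin n) (Fin n) ℝ)
        = (B ⊗ₖ (1 : Matrix (Fin n) (Fin n) ℝ)).transpose := by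
      rw [← Matrix.kroneckerMap_transpose, Matrix.transpose_one]
    rw [this, Matrix.mulVec_transpose, dotProduct_comm, ← Matrix.dotProduct_mulVec]
  simp only [Matrix.inner_toEuclideanCLM, drift, symDrift, symLaplacian, Matrix.add_mulVec,
    Matrix.smul_mulVec, dotProduct_add, dotProduct_smul, Matrix.smul_kronecker,
    Matrix.add_kronecker, key, smul_eq_mul]
  ring

theorem sum_neighbors_smul {V : Type*} [AddCommGroup V] [Module ℝ V] (k : ℕ) (ω : Ω) (i : Fin N)
    (F : Fin N → V) :
    ∑ j ∈ M.neighbors k ω i, M.A k ω i j • F j = ∑ j, M.A k ω i j • F j := by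
  refine Finset.sum_subset (Finset.subset_univ _) fun j _ hj => ?_
  have : M.A k ω i j = 0 := by simpa [neighbors] using hj
  simp [this]

/-- The stacked estimation errors at instant `k`. -/
def error (a b : ℕ → ℝ) (init : Fin N → EuclideanSpace ℝ (Fin n)) (k : ℕ) (ω : Ω) :
    EuclideanSpace ℝ (Fin N × Fin n) :=
  stack fun i => M.estimate a b (fun _ => 0) init k ω i - M.x₀

/-- The stacked contributions of the noises at instant `k`, when the estimates are `x`. -/
def noiseTerm (a b : ℕ → ℝ) (init : Fin N → EuclideanSpace ℝ (Fin n)) (k : ℕ) (ω : Ω) :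
    EuclideanSpace ℝ (Fin N × Fin n) :=
  stack fun i => a k • Matrix.toEuclideanLin (M.H i k ω).transpose (M.v i k ω)
    + b k • ∑ j, M.A k ω i j • M.f j i (M.estimate a b (fun _ => 0) init k ω j
        - M.estimate a b (fun _ => 0) init k ω i) • M.ξ j i k ω

theorem sum_laplacian_smul (k : ℕ) (ω : Ω) (i : Fin N) (x : Fin N → EuclideanSpace ℝ (Fin n)) :
    ∑ j, M.laplacian k ω i j • x j = - ∑ j, M.A k ω i j • (x j - x i) := by
  simp only [laplacian, Matrix.sub_apply, sub_smul, smul_sub, Finset.sum_sub_distrib,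
    Matrix.diagonal_apply, ite_smul, zero_smul, Finset.sum_ite_eq, Finset.mem_univ, if_true,
    Finset.sum_smul]
  abel

theorem error_succ (a b : ℕ → ℝ) (init : Fin N → EuclideanSpace ℝ (Fin n)) (k : ℕ) (ω : Ω) :
    M.error a b init (k + 1) ω = M.error a b init k ω
      - Matrix.toEuclideanCLM (𝕜 := ℝ) (M.drift a b k ω) (M.error a b init k ω)
      + M.noiseTerm a b init k ω := by
  have hD : Matrix.toEuclideanCLM (𝕜 := ℝ) (M.drift a b k ω) (M.error a b init k ω)
      = b k • stack (fun i => ∑ j, M.laplacian k ω i j •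
          (M.estimate a b (fun _ => 0) init k ω j - M.x₀))
        + a k • stack (fun i => Matrix.toEuclideanLin (M.H i k ω).transpose
          (Matrix.toEuclideanLin (M.H i k ω)
            (M.estimate a b (fun _ => 0) init k ω i - M.x₀))) := by
    rw [error, drift, map_add, map_smul, map_smul, add_apply,
      smul_apply, smul_apply,
      toEuclideanCLM_kronecker_one_stack, toEuclideanCLM_gram_stack]
  rw [hD]
  simp only [sum_laplacian_smul]
  ext p
  obtain ⟨i, c⟩ := p
  -- The consensus sum may be written with differences of errors, since x₀ cancels in them, and over
  -- all nodes, since non-neighbors have weight zero.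
  have : M.estimate a b (fun _ => 0) init (k + 1) ω i - M.x₀
      = (M.estimate a b (fun _ => 0) init k ω i - M.x₀)
        - (b k • -∑ j, M.A k ω i j • ((M.estimate a b (fun _ => 0) init k ω j - M.x₀)
            - (M.estimate a b (fun _ => 0) init k ω i - M.x₀))
          + a k • Matrix.toEuclideanLin (M.H i k ω).transpose
          (Matrix.toEuclideanLin (M.H i k ω)
            (M.estimate a b (fun _ => 0) init k ω i - M.x₀)))
        + (a k • Matrix.toEuclideanLin (M.H i k ω).transpose (M.v i k ω)
          + b k • ∑ j, M.A k ω i j • M.f j i (M.estimate a b (fun _ => 0) init k ω j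
        - M.estimate a b (fun _ => 0) init k ω i) • M.ξ j i k ω) := by
    simp only [estimate, sum_neighbors_smul, received, y, zero_smul, sub_zero, map_sub, map_add,
      sub_sub_sub_cancel_right]
    have h1 : ∀ j, M.A k ω i j • (M.estimate a b (fun _ => 0) init k ω j
          + M.f j i (M.estimate a b (fun _ => 0) init k ω j
            - M.estimate a b (fun _ => 0) init k ω i) • M.ξ j i k ω
          - M.estimate a b (fun _ => 0) init k ω i)
        = M.A k ω i j • (M.estimate a b (fun _ => 0) init k ω j
            - M.estimate a b (fun _ => 0) init k ω i)
          + M.A k ω i j • M.f j i (M.estimate a b (fun _ => 0) init k ω j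
            - M.estimate a b (fun _ => 0) init k ω i) • M.ξ j i k ω := fun j => by
      rw [← smul_add]; congr 1; abel
    simp only [h1, Finset.sum_add_distrib, smul_add, smul_sub, smul_neg]
    abel
  exact congrArg (fun z : EuclideanSpace ℝ (Fin n) => z c) this

end Model
end DecentralizedRegression
end

noncomputable section
namespace DecentralizedRegression

/-! ### Measurability and the information σ-algebras -/

section Measurability

variable {α : Type*} {m : MeasurableSpace α} {ι κ : Type*} [Fintype ι] [Fintype κ]
  [DecidableEq ι] [DecidableEq κ]

theorem measurable_euclideanSpace_of_apply {f : α → EuclideanSpace ℝ ι}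
    (hf : ∀ c, Measurable fun ω => f ω c) : Measurable f :=
  (WithLp.measurable_toLp 2 (ι → ℝ)).comp (measurable_pi_iff.2 hf)

theorem measurable_euclideanSpace_apply {f : α → EuclideanSpace ℝ ι} (hf : Measurable f) (c : ι) :
    Measurable fun ω => f ω c :=
  (measurable_pi_apply c).comp ((WithLp.measurable_ofLp 2 (ι → ℝ)).comp hf)

theorem measurable_toEuclideanLin_apply {B : α → Matrix ι κ ℝ} {x : α → EuclideanSpace ℝ κ}
    (hB : ∀ i j, Measurable fun ω => B ω i j) (hx : Measurable x) :
    Measurable fun ω => Matrix.toEuclideanLin (B ω) (x ω) := by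
  refine measurable_euclideanSpace_of_apply fun i => ?_
  simp only [Matrix.ofLp_toLpLin, Matrix.toLin'_apply, Matrix.mulVec, dotProduct]
  exact Finset.measurable_fun_sum _ fun j _ => (hB i j).mul (measurable_euclideanSpace_apply hx j)

theorem measurable_of_linear_matrix {F : Type*} [NormedAddCommGroup F] [NormedSpace ℝ F]
    [MeasurableSpace F] [BorelSpace F] (T : Matrix ι κ ℝ →ₗ[ℝ] F) {B : α → Matrix ι κ ℝ}
    (hB : ∀ i j, Measurable fun ω => B ω i j) : StronglyMeasurable fun ω => T (B ω) := by
  have hc : Continuous (T ∘ₗ (Matrix.ofLinearEquiv ℝ).toLinearMap : (ι → κ → ℝ) →ₗ[ℝ] F) :=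
    LinearMap.continuous_of_finiteDimensional _
  have hm : Measurable fun ω => (fun i j => B ω i j : ι → κ → ℝ) :=
    measurable_pi_iff.2 fun i => measurable_pi_iff.2 fun j => hB i j
  exact hc.comp_stronglyMeasurable hm.stronglyMeasurable

theorem stronglyMeasurable_toEuclideanCLM {B : α → Matrix ι ι ℝ}
    (hB : ∀ i j, Measurable fun ω => B ω i j) :
    StronglyMeasurable fun ω => Matrix.toEuclideanCLM (𝕜 := ℝ) (B ω) := by
  borelize (EuclideanSpace ℝ ι →L[ℝ] EuclideanSpace ℝ ι)
  exact measurable_of_linear_matrix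
    (Matrix.toEuclideanCLM (n := ι) (𝕜 := ℝ)).toAlgEquiv.toLinearEquiv.toLinearMap hB

theorem measurable_l2_opNorm {B : α → Matrix ι ι ℝ} (hB : ∀ i j, Measurable fun ω => B ω i j) :
    Measurable fun ω => ‖B ω‖ :=
  (stronglyMeasurable_toEuclideanCLM hB).norm.measurable

variable {N n : ℕ}

theorem measurable_stack {x : α → Fin N → EuclideanSpace ℝ (Fin n)}
    (hx : ∀ i, Measurable fun ω => x ω i) : Measurable fun ω => stack (x ω) :=
  measurable_euclideanSpace_of_apply fun p => measurable_euclideanSpace_apply (hx p.1) p.2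

theorem measurable_block {z : α → EuclideanSpace ℝ (Fin N × Fin n)} (hz : Measurable z)
    (i : Fin N) : Measurable fun ω => block (z ω) i :=
  measurable_euclideanSpace_of_apply fun c => measurable_euclideanSpace_apply hz (i, c)

end Measurability

namespace Model

section SubSigmaAlgebra

variable {Ω : Type*} {m : MeasurableSpace Ω} [mΩ : MeasurableSpace Ω] {N n : ℕ} {d : Fin N → ℕ}
  (M : Model Ω N n d)

theorem measurable_laplacian_of {k : ℕ}
    (hA : ∀ i j, Measurable[m] fun ω => M.A k ω i j) (i j : Fin N) :
    Measurable[m] fun ω => M.laplacian k ω i j := by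
  simp only [laplacian, Matrix.sub_apply, Matrix.diagonal_apply]
  refine Measurable.sub ?_ (hA i j)
  split_ifs
  · exact Finset.measurable_fun_sum _ fun j _ => hA i j
  · exact measurable_const

theorem measurable_gram_of {k : ℕ}
    (hH : ∀ i r c, Measurable[m] fun ω => M.H i k ω r c) (p q : Fin N × Fin n) :
    Measurable[m] fun ω => M.gram k ω p q := by
  simp only [gram_apply]
  split_ifs
  · exact Finset.measurable_fun_sum _ fun r _ => (hH _ _ _).mul (hH _ _ _)
  · exact measurable_const

theorem measurable_drift_of (a b : ℕ → ℝ) {k : ℕ}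
    (hA : ∀ i j, Measurable[m] fun ω => M.A k ω i j)
    (hH : ∀ i r c, Measurable[m] fun ω => M.H i k ω r c) (p q : Fin N × Fin n) :
    Measurable[m] fun ω => M.drift a b k ω p q :=
  ((((M.measurable_laplacian_of hA p.1 q.1).mul_const _).const_mul (b k))).add
    ((M.measurable_gram_of hH p q).const_mul (a k))

theorem measurable_noiseTerm_summand {k : ℕ}
    (hA : ∀ i j, Measurable[m] fun ω => M.A k ω i j)
    {x : Ω → Fin N → EuclideanSpace ℝ (Fin n)} (hx : ∀ i, Measurable[m] fun ω => x ω i)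
    (i j : Fin N) :
    Measurable[m] fun ω => M.A k ω i j * M.f j i (x ω j - x ω i) :=
  (hA i j).mul ((M.measurable_f j i).comp ((hx j).sub (hx i)))

theorem measurable_estimate_succ_of (a b lam : ℕ → ℝ) (init : Fin N → EuclideanSpace ℝ (Fin n))
    {k : ℕ} (hA : ∀ i j, Measurable[m] fun ω => M.A k ω i j)
    (hH : ∀ i r c, Measurable[m] fun ω => M.H i k ω r c) (hv : ∀ i, Measurable[m] (M.v i k))
    (hξ : ∀ j i, Measurable[m] (M.ξ j i k))
    (hx : ∀ i, Measurable[m] fun ω => M.estimate a b lam init k ω i) (i : Fin N) :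
    Measurable[m] fun ω => M.estimate a b lam init (k + 1) ω i := by
  simp only [estimate, sum_neighbors_smul, received, y]
  have h1 : Measurable[m] fun ω => Matrix.toEuclideanLin (M.H i k ω) M.x₀ + M.v i k ω
      - Matrix.toEuclideanLin (M.H i k ω) (M.estimate a b lam init k ω i) :=
    ((measurable_toEuclideanLin_apply (hH i) measurable_const).add (hv i)).sub
      (measurable_toEuclideanLin_apply (hH i) (hx i))
  have h2 := (measurable_toEuclideanLin_apply (B := fun ω => (M.H i k ω).transpose)
    (fun c r => hH i r c) h1).const_smul (a k)
  have h3 : ∀ j, Measurable[m] fun ω => M.A k ω i j • (M.estimate a b lam init k ω j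
      + M.f j i (M.estimate a b lam init k ω j - M.estimate a b lam init k ω i) • M.ξ j i k ω
      - M.estimate a b lam init k ω i) := fun j =>
    (hA i j).smul
      (((hx j).add (((M.measurable_f j i).comp ((hx j).sub (hx i))).smul (hξ j i))).sub (hx i))
  have h4 := (Finset.measurable_fun_sum Finset.univ fun j _ => h3 j).const_smul (b k)
  exact (((hx i).add h2).add h4).sub ((hx i).const_smul (lam k))

end SubSigmaAlgebra

variable {Ω : Type*} [mΩ : MeasurableSpace Ω] {N n : ℕ} {d : Fin N → ℕ} (M : Model Ω N n d)

theorem regressorSigma_le (s : ℕ) : M.regressorSigma s ≤ mΩ :=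
  sup_le (iSup₂_le fun i j => (M.measurable_A s i j).comap_le)
    (iSup_le fun i => iSup₂_le fun r c => (M.measurable_H i s r c).comap_le)

theorem noiseSigma_le (s : ℕ) : M.noiseSigma s ≤ mΩ :=
  sup_le (iSup_le fun i => (M.measurable_v i s).comap_le)
    (iSup₂_le fun j i => (M.measurable_ξ j i s).comap_le)

theorem past_le (k : ℕ) : M.past k ≤ mΩ :=
  iSup₂_le fun s _ => sup_le (M.regressorSigma_le s) (M.noiseSigma_le s)

theorem past_mono : Monotone M.past := fun _ _ hkl =>
  iSup₂_le fun s hs => le_iSup₂_of_le s (hs.trans_le hkl) le_rfl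

/-- The filtration `k ↦ ℱ(k - 1)`. -/
def pastFiltration : Filtration ℕ mΩ := ⟨M.past, M.past_mono, M.past_le⟩

/-- The `σ`-algebra generated by the noises before instant `k`. -/
@[reducible] def noisePast (k : ℕ) : MeasurableSpace Ω := ⨆ s, ⨆ _ : s < k, M.noiseSigma s

/-- The `σ`-algebra generated by the noises before instant `k` and by all graphs and regression
matrices. -/
@[reducible] def enlargedPast (k : ℕ) : MeasurableSpace Ω :=
  M.noisePast k ⊔ ⨆ s, M.regressorSigma s

theorem noisePast_le_past (k : ℕ) : M.noisePast k ≤ M.past k :=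
  iSup₂_mono fun _ _ => le_sup_right

theorem noisePast_le_iSup (k : ℕ) : M.noisePast k ≤ ⨆ s, M.noiseSigma s :=
  iSup₂_le fun s _ => le_iSup M.noiseSigma s

theorem enlargedPast_le (k : ℕ) : M.enlargedPast k ≤ mΩ :=
  sup_le ((M.noisePast_le_past k).trans (M.past_le k)) (iSup_le M.regressorSigma_le)

theorem past_le_enlargedPast (k : ℕ) : M.past k ≤ M.enlargedPast k :=
  iSup₂_le fun s hs => sup_le (le_sup_of_le_right (le_iSup M.regressorSigma s))
    (le_sup_of_le_left (le_iSup₂_of_le s hs le_rfl))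

theorem measurable_A_regressorSigma (s : ℕ) (i j : Fin N) :
    Measurable[M.regressorSigma s] fun ω => M.A s ω i j :=
  measurable_iff_comap_le.2 (le_sup_of_le_left (le_iSup₂_of_le i j le_rfl))

theorem measurable_H_regressorSigma (s : ℕ) (i : Fin N) (r : Fin (d i)) (c : Fin n) :
    Measurable[M.regressorSigma s] fun ω => M.H i s ω r c :=
  measurable_iff_comap_le.2
    (le_sup_of_le_right (le_iSup_of_le i (le_iSup₂_of_le r c le_rfl)))

theorem measurable_v_noiseSigma (s : ℕ) (i : Fin N) : Measurable[M.noiseSigma s] (M.v i s) :=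
  measurable_iff_comap_le.2 (le_sup_of_le_left (le_iSup_of_le i le_rfl))

theorem measurable_ξ_noiseSigma (s : ℕ) (j i : Fin N) : Measurable[M.noiseSigma s] (M.ξ j i s) :=
  measurable_iff_comap_le.2 (le_sup_of_le_right (le_iSup₂_of_le j i le_rfl))

theorem regressorSigma_le_enlargedPast (s k : ℕ) : M.regressorSigma s ≤ M.enlargedPast k :=
  le_sup_of_le_right (le_iSup M.regressorSigma s)

theorem measurable_symLaplacian (k : ℕ) (i j : Fin N) :
    Measurable fun ω => M.symLaplacian k ω i j :=
  ((M.measurable_laplacian_of (M.measurable_A k) i j).add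
    (M.measurable_laplacian_of (M.measurable_A k) j i)).const_mul 2⁻¹

theorem measurable_estimate (a b lam : ℕ → ℝ) (init : Fin N → EuclideanSpace ℝ (Fin n)) (k : ℕ)
    (i : Fin N) : Measurable[M.past k] fun ω => M.estimate a b lam init k ω i := by
  induction k generalizing i with
  | zero => exact measurable_const
  | succ k ih =>
    have hle : M.regressorSigma k ⊔ M.noiseSigma k ≤ M.past (k + 1) :=
      le_iSup₂_of_le k (Nat.lt_succ_self k) le_rfl
    have hr := le_sup_left.trans hle
    have hn := le_sup_right.trans hle
    have hx : ∀ i, Measurable[M.past (k + 1)] fun ω => M.estimate a b lam init k ω i :=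
      fun i => (ih i).mono (M.past_mono k.le_succ) le_rfl
    have hA := fun i j => (M.measurable_A_regressorSigma k i j).mono hr le_rfl
    have hH := fun i r c => (M.measurable_H_regressorSigma k i r c).mono hr le_rfl
    have hv := fun i => (M.measurable_v_noiseSigma k i).mono hn le_rfl
    have hξ := fun j i => (M.measurable_ξ_noiseSigma k j i).mono hn le_rfl
    exact M.measurable_estimate_succ_of a b lam init hA hH hv hξ hx i

theorem measurable_error (a b : ℕ → ℝ) (init : Fin N → EuclideanSpace ℝ (Fin n)) (k : ℕ) :
    Measurable[M.past k] (M.error a b init k) :=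
  measurable_stack fun i => (M.measurable_estimate a b _ init k i).sub measurable_const

variable {μ : Measure Ω} [IsProbabilityMeasure μ]

/-- Independence removes the regressors from the conditioning, leaving the past noises alone; the
tower property then inserts the full past, where the martingale hypotheses apply. -/
theorem condExp_enlargedPast_eq (hind : Indep (⨆ k, M.noiseSigma k) (⨆ k, M.regressorSigma k) μ)
    {F : Type*} [NormedAddCommGroup F] [NormedSpace ℝ F] [CompleteSpace F] {k : ℕ} {η : Ω → F}
    (hη : StronglyMeasurable[⨆ k, M.noiseSigma k] η) (hηi : Integrable η μ) :
    μ[η | M.enlargedPast k] =ᵐ[μ] μ[μ[η | M.past k] | M.noisePast k] :=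
  (condExp_sup_of_indep (iSup_le M.noiseSigma_le) (iSup_le M.regressorSigma_le)
    (M.noisePast_le_iSup k) hind hη hηi).trans
    (condExp_condExp_of_le (M.noisePast_le_past k) (M.past_le k)).symm

theorem condExp_enlargedPast_eq_zero
    (hind : Indep (⨆ k, M.noiseSigma k) (⨆ k, M.regressorSigma k) μ)
    {F : Type*} [NormedAddCommGroup F] [NormedSpace ℝ F] [CompleteSpace F] {k : ℕ} {η : Ω → F}
    (hη : StronglyMeasurable[⨆ k, M.noiseSigma k] η) (hηi : Integrable η μ)
    (h0 : μ[η | M.past k] =ᵐ[μ] 0) : μ[η | M.enlargedPast k] =ᵐ[μ] 0 := by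
  refine (M.condExp_enlargedPast_eq hind hη hηi).trans ((condExp_congr_ae h0).trans ?_)
  rw [condExp_zero]

theorem measurable_noiseSq (k : ℕ) : Measurable[⨆ k, M.noiseSigma k] (M.noiseSq k) := by
  have hv := fun i => (M.measurable_v_noiseSigma k i).mono (le_iSup M.noiseSigma k) le_rfl
  have hξ := fun j i => (M.measurable_ξ_noiseSigma k j i).mono (le_iSup M.noiseSigma k) le_rfl
  exact (Finset.measurable_fun_sum _ fun i _ => (measurable_norm.comp (hv i)).pow_const 2).add
    (Finset.measurable_fun_sum _ fun j _ => Finset.measurable_fun_sum _ fun i _ =>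
      (measurable_norm.comp (hξ j i)).pow_const 2)

theorem condExp_noiseSq_le (hA2 : M.NoiseAssumption μ) {β : ℝ} {k : ℕ}
    (hβ : ∀ᵐ ω ∂μ, (μ[M.noiseSq k | M.past k]) ω ≤ β) :
    ∀ᵐ ω ∂μ, (μ[M.noiseSq k | M.enlargedPast k]) ω ≤ β := by
  have h1 : μ[μ[M.noiseSq k | M.past k] | M.noisePast k] ≤ᵐ[μ]
      μ[fun _ => β | M.noisePast k] :=
    condExp_mono integrable_condExp (integrable_const β) hβ
  rw [condExp_const ((M.noisePast_le_past k).trans (M.past_le k))] at h1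
  filter_upwards [h1, M.condExp_enlargedPast_eq hA2.indep
    (M.measurable_noiseSq k).stronglyMeasurable (hA2.integrable_sq k)] with ω h1 h2
  rw [h2]
  exact h1

theorem setIntegral_inner_eq_zero_of_condExp {F : Type*} [NormedAddCommGroup F]
    [InnerProductSpace ℝ F] [CompleteSpace F] {m : MeasurableSpace Ω} (hm : m ≤ mΩ) {Z η : Ω → F}
    (hZ : StronglyMeasurable[m] Z) (hη : Integrable η μ)
    (hZη : Integrable (fun ω => inner ℝ (Z ω) (η ω)) μ) (h0 : μ[η | m] =ᵐ[μ] 0) {S : Set Ω}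
    (hS : MeasurableSet[m] S) : ∫ ω in S, inner ℝ (Z ω) (η ω) ∂μ = 0 := by
  rw [← setIntegral_condExp hm hZη hS]
  have h1 : μ[fun ω => inner ℝ (Z ω) (η ω) | m] =ᵐ[μ] fun ω => inner ℝ (Z ω) ((μ[η | m]) ω) :=
    condExp_bilin_of_stronglyMeasurable_left (innerSL ℝ) hZ hZη hη
  refine integral_eq_zero_of_ae (ae_restrict_of_ae ?_)
  filter_upwards [h1, h0] with ω h1 h2
  rw [h1, h2]
  simp

end Model
end DecentralizedRegression
end

noncomputable section
namespace DecentralizedRegression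

theorem memLp_two_of_norm_sq_le {Ω F : Type*} [MeasurableSpace Ω] [NormedAddCommGroup F]
    {μ : Measure Ω} {f : Ω → F} {B : Ω → ℝ} (hf : AEStronglyMeasurable f μ) (hB : Integrable B μ)
    (h : ∀ᵐ ω ∂μ, ‖f ω‖ ^ 2 ≤ B ω) : MemLp f 2 μ := by
  rw [memLp_two_iff_integrable_sq_norm hf]
  refine hB.mono' (hf.norm.pow 2) ?_
  filter_upwards [h] with ω hω
  rwa [Real.norm_of_nonneg (by positivity)]

theorem norm_smul_add_smul_sq_le {F : Type*} [NormedAddCommGroup F] [NormedSpace ℝ F] (s t : ℝ)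
    (x y : F) : ‖s • x + t • y‖ ^ 2 ≤ (s ^ 2 + t ^ 2) * (‖x‖ ^ 2 + ‖y‖ ^ 2) := by
  have h1 : ‖s • x + t • y‖ ≤ |s| * ‖x‖ + |t| * ‖y‖ := by
    simpa [norm_smul] using norm_add_le (s • x) (t • y)
  calc _ ≤ (|s| * ‖x‖ + |t| * ‖y‖) ^ 2 := by gcongr
    _ ≤ (|s| ^ 2 + |t| ^ 2) * (‖x‖ ^ 2 + ‖y‖ ^ 2) := by
        nlinarith [sq_nonneg (|s| * ‖y‖ - |t| * ‖x‖)]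
    _ = _ := by simp only [sq_abs]

namespace Model

variable {Ω : Type*} [mΩ : MeasurableSpace Ω] {N n : ℕ} {d : Fin N → ℕ} (M : Model Ω N n d)

/-- A random scale dominating the spectral norms of the Laplacian and of the Gram matrix. -/
def scale (ρ : ℝ) (k : ℕ) (ω : Ω) : ℝ := ρ ^ 2 + 1 + ‖M.gram k ω‖ ^ 2

/-! ### Moment bounds for drift and noise -/

section Bounds

variable {μ : Measure Ω} [IsProbabilityMeasure μ] {h : ℕ} {ρ : ℝ}

theorem scale_nonneg (k : ℕ) (ω : Ω) : 0 ≤ M.scale ρ k ω := by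
  unfold scale; positivity

theorem norm_gram_le_scale (k : ℕ) (ω : Ω) : ‖M.gram k ω‖ ≤ M.scale ρ k ω := by
  unfold scale; nlinarith [sq_nonneg (‖M.gram k ω‖ - 1), sq_nonneg ρ, sq_nonneg ‖M.gram k ω‖]

theorem measurable_scale (k l : ℕ) : Measurable[M.enlargedPast l] (M.scale ρ k) := by
  have := measurable_l2_opNorm (M.measurable_gram_of fun i r c =>
    (M.measurable_H_regressorSigma k i r c).mono (M.regressorSigma_le_enlargedPast k l) le_rfl)
  exact measurable_const.add (this.pow_const 2)

/-- The inequality t² ≤ 1 + tᵖ for t ≥ 0 uses nothing about the exponent except p ≥ 2. -/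
theorem scale_le (k : ℕ) (ω : Ω) :
    M.scale ρ k ω ≤ (ρ ^ 2 + 2) + ‖M.gram k ω‖ ^ (2 ^ max h 2) := by
  have hp : 2 ≤ 2 ^ max h 2 := by
    calc 2 = 2 ^ 1 := rfl
      _ ≤ 2 ^ max h 2 := Nat.pow_le_pow_right (by norm_num) (by omega)
  unfold scale
  rcases le_total ‖M.gram k ω‖ 1 with h1 | h1
  · have : ‖M.gram k ω‖ ^ 2 ≤ 1 := pow_le_one₀ (norm_nonneg _) h1
    have : 0 ≤ ‖M.gram k ω‖ ^ (2 ^ max h 2) := by positivity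
    linarith
  · have := pow_le_pow_right₀ h1 hp
    linarith

theorem integrable_scale (hb : M.UniformBound μ h ρ) (k : ℕ) : Integrable (M.scale ρ k) μ := by
  refine ((integrable_const (ρ ^ 2 + 2)).add (hb.integrable k)).mono'
    ((M.measurable_scale k k).mono (M.enlargedPast_le k) le_rfl).aestronglyMeasurable
    (ae_of_all _ fun ω => ?_)
  rw [Real.norm_of_nonneg (M.scale_nonneg k ω)]
  exact M.scale_le k ω

theorem condExp_pow_gram_nonneg (k : ℕ) :
    ∀ᵐ ω ∂μ, 0 ≤ (μ[fun ω' => ‖M.gram k ω'‖ ^ (2 ^ max h 2) | M.past k]) ω :=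
  condExp_nonneg (ae_of_all _ fun ω => by positivity)

theorem norm_laplacian_le (hb : M.UniformBound μ h ρ) :
    ∀ᵐ ω ∂μ, ∀ k, ‖M.laplacian k ω‖ ≤ ρ := by
  filter_upwards [hb.bound, ae_all_iff.2 fun k => M.condExp_pow_gram_nonneg (μ := μ) (h := h) k]
    with ω h1 h2 k
  linarith [h1 k, Real.rpow_nonneg (h2 k) ((1 : ℝ) / 2 ^ max h 2)]

theorem condExp_scale_le (hb : M.UniformBound μ h ρ) (k : ℕ) :
    ∀ᵐ ω ∂μ, (μ[M.scale ρ k | M.past k]) ω ≤ ρ ^ 2 + 2 + ρ ^ (2 ^ max h 2) := by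
  have h1 : μ[M.scale ρ k | M.past k] ≤ᵐ[μ]
      μ[(fun _ => ρ ^ 2 + 2) + (fun ω => ‖M.gram k ω‖ ^ (2 ^ max h 2)) | M.past k] :=
    condExp_mono (M.integrable_scale hb k) ((integrable_const _).add (hb.integrable k))
      (ae_of_all _ fun ω => M.scale_le k ω)
  have h2 := condExp_add (μ := μ) (integrable_const (ρ ^ 2 + 2)) (hb.integrable k) (M.past k)
  rw [condExp_const (M.past_le k)] at h2
  filter_upwards [h1, h2, hb.bound, M.condExp_pow_gram_nonneg (μ := μ) (h := h) k]
    with ω h1 h2 h3 h4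
  rw [h2] at h1
  refine h1.trans (add_le_add le_rfl ?_)
  -- Dropping the nonnegative Laplacian term isolates the p-th root; raising it back to the power p
  -- gives a bound on the moment itself.
  have h5 : ((μ[fun ω' => ‖M.gram k ω'‖ ^ (2 ^ max h 2) | M.past k]) ω) ^
      ((1 : ℝ) / 2 ^ max h 2) ≤ ρ := by linarith [h3 k, norm_nonneg (M.laplacian k ω)]
  have h6 := pow_le_pow_left₀ (Real.rpow_nonneg h4 _) h5 (2 ^ max h 2)
  have h7 := Real.rpow_inv_natCast_pow h4 (n := 2 ^ max h 2) (by positivity)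
  rw [Nat.cast_pow, Nat.cast_ofNat, ← one_div] at h7
  rwa [h7] at h6

end Bounds

section NoiseBounds

variable (a b : ℕ → ℝ) (init : Fin N → EuclideanSpace ℝ (Fin n))

/-- Two estimates differ by at most twice the error norm V, and (2σV + c)² ≤ 8σ²V² + 2c² by the
parallelogram inequality. -/
theorem sq_intensity_le {σ c : ℝ} (hf : ∀ j i x, |M.f j i x| ≤ σ * ‖x‖ + c) (k : ℕ) (ω : Ω)
    (i j : Fin N) :
    M.f j i (M.estimate a b (fun _ => 0) init k ω j - M.estimate a b (fun _ => 0) init k ω i) ^ 2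
      ≤ (8 * σ ^ 2 + 2 * c ^ 2) * (‖M.error a b init k ω‖ ^ 2 + 1) := by
  set x := M.estimate a b (fun _ => 0) init k ω
  set V := ‖M.error a b init k ω‖
  have hV : 0 ≤ V := norm_nonneg _
  have h1 : ‖x j - M.x₀‖ ≤ V := norm_le_norm_stack (fun i => x i - M.x₀) j
  have h2 : ‖x i - M.x₀‖ ≤ V := norm_le_norm_stack (fun i => x i - M.x₀) i
  have h3 : ‖x j - x i‖ ≤ 2 * V := by
    calc ‖x j - x i‖ = ‖(x j - M.x₀) - (x i - M.x₀)‖ := by rw [sub_sub_sub_cancel_right]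
      _ ≤ _ := (norm_sub_le _ _).trans (by linarith)
  have h4 : ‖x j - x i‖ ^ 2 ≤ (2 * V) ^ 2 := by gcongr
  have h5 : M.f j i (x j - x i) ^ 2 ≤ (σ * ‖x j - x i‖ + c) ^ 2 := by
    rw [← sq_abs]; gcongr; exact hf j i _
  have h6 := mul_le_mul_of_nonneg_left h4 (sq_nonneg σ)
  nlinarith [sq_nonneg (σ * ‖x j - x i‖ - c), mul_nonneg (sq_nonneg c) (sq_nonneg V), sq_nonneg σ]

theorem norm_sq_channel_le {σ c ρ : ℝ} (hf : ∀ j i x, |M.f j i x| ≤ σ * ‖x‖ + c) {k : ℕ} {ω : Ω}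
    (hL : ‖M.laplacian k ω‖ ≤ ρ) (i j : Fin N) :
    ‖M.A k ω i j • M.f j i (M.estimate a b (fun _ => 0) init k ω j
        - M.estimate a b (fun _ => 0) init k ω i) • M.ξ j i k ω‖ ^ 2
      ≤ ρ ^ 2 * (8 * σ ^ 2 + 2 * c ^ 2) * (‖M.error a b init k ω‖ ^ 2 + 1)
        * ‖M.ξ j i k ω‖ ^ 2 := by
  have h1 : M.A k ω i j ^ 2 ≤ ρ ^ 2 := by
    rw [← sq_abs]
    have := (M.abs_A_le k ω i j).trans hL
    gcongr
  rw [norm_smul, norm_smul, mul_pow, mul_pow, Real.norm_eq_abs, Real.norm_eq_abs, sq_abs, sq_abs]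
  have h2 := M.sq_intensity_le a b init hf k ω i j
  calc _ ≤ ρ ^ 2 * (((8 * σ ^ 2 + 2 * c ^ 2) * (‖M.error a b init k ω‖ ^ 2 + 1))
        * ‖M.ξ j i k ω‖ ^ 2) := by gcongr
    _ = _ := by ring

theorem norm_v_sq_le_noiseSq (k : ℕ) (ω : Ω) (i : Fin N) :
    ‖M.v i k ω‖ ^ 2 ≤ M.noiseSq k ω := by
  have h1 := Finset.single_le_sum (f := fun i => ‖M.v i k ω‖ ^ 2) (fun j _ => sq_nonneg _)
    (Finset.mem_univ i)
  have h2 : 0 ≤ ∑ j, ∑ i, ‖M.ξ j i k ω‖ ^ 2 :=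
    Finset.sum_nonneg fun j _ => Finset.sum_nonneg fun i _ => sq_nonneg _
  simp only [noiseSq] at h1 ⊢
  linarith

theorem norm_ξ_sq_le_noiseSq (k : ℕ) (ω : Ω) (j i : Fin N) :
    ‖M.ξ j i k ω‖ ^ 2 ≤ M.noiseSq k ω := by
  have h1 := Finset.single_le_sum (f := fun i => ‖M.ξ j i k ω‖ ^ 2) (fun j _ => sq_nonneg _)
    (Finset.mem_univ i)
  have h3 := Finset.single_le_sum (f := fun j => ∑ i, ‖M.ξ j i k ω‖ ^ 2)
    (fun j _ => by positivity) (Finset.mem_univ j)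
  have h2 : 0 ≤ ∑ i, ‖M.v i k ω‖ ^ 2 := Finset.sum_nonneg fun i _ => sq_nonneg _
  simp only [noiseSq] at h1 h3 ⊢
  linarith

theorem noiseSq_nonneg (k : ℕ) (ω : Ω) : 0 ≤ M.noiseSq k ω :=
  add_nonneg (Finset.sum_nonneg fun i _ => sq_nonneg _)
    (Finset.sum_nonneg fun j _ => Finset.sum_nonneg fun i _ => sq_nonneg _)

/-- Cauchy–Schwarz over the N channels of a node produces the factor `N`. The result is a weight,
known given the enlarged past, times the noise energy. -/
theorem norm_sq_noiseTerm_le {σ c ρ : ℝ} (hf : ∀ j i x, |M.f j i x| ≤ σ * ‖x‖ + c) {k : ℕ} {ω : Ω}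
    (hL : ‖M.laplacian k ω‖ ≤ ρ) :
    ‖M.noiseTerm a b init k ω‖ ^ 2 ≤ (a k ^ 2 + b k ^ 2) * ((M.scale ρ k ω
      + N * (ρ ^ 2 * (8 * σ ^ 2 + 2 * c ^ 2)) * (‖M.error a b init k ω‖ ^ 2 + 1))
        * M.noiseSq k ω) := by
  rw [noiseTerm, norm_sq_stack]
  set V1 := ‖M.error a b init k ω‖ ^ 2 + 1
  set κ := ρ ^ 2 * (8 * σ ^ 2 + 2 * c ^ 2)
  have hκ : 0 ≤ κ := by positivity
  have hV : 0 ≤ V1 := by positivity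
  have h1 : ∀ i, ‖∑ j, M.A k ω i j • M.f j i (M.estimate a b (fun _ => 0) init k ω j
        - M.estimate a b (fun _ => 0) init k ω i) • M.ξ j i k ω‖ ^ 2
      ≤ N * ∑ j, κ * V1 * ‖M.ξ j i k ω‖ ^ 2 := by
    intro i
    refine (pow_le_pow_left₀ (norm_nonneg _) (norm_sum_le _ _) 2).trans ?_
    refine sq_sum_le_card_mul_sum_sq.trans ?_
    rw [Finset.card_univ, Fintype.card_fin]
    gcongr with j
    exact M.norm_sq_channel_le a b init hf hL i j
  calc _ ≤ ∑ i, (a k ^ 2 + b k ^ 2) * (M.scale ρ k ω * ‖M.v i k ω‖ ^ 2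
        + N * ∑ j, κ * V1 * ‖M.ξ j i k ω‖ ^ 2) := by
        refine Finset.sum_le_sum fun i _ => (norm_smul_add_smul_sq_le _ _ _ _).trans ?_
        gcongr
        · exact (M.norm_transpose_H_sq_le k ω i _).trans
            (mul_le_mul_of_nonneg_right (M.norm_gram_le_scale k ω) (by positivity))
        · exact h1 i
    _ = (a k ^ 2 + b k ^ 2) * (M.scale ρ k ω * (∑ i, ‖M.v i k ω‖ ^ 2)
        + N * κ * V1 * ∑ j, ∑ i, ‖M.ξ j i k ω‖ ^ 2) := by
        rw [Finset.sum_comm (f := fun j i => ‖M.ξ j i k ω‖ ^ 2)]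
        simp only [← Finset.mul_sum, Finset.sum_add_distrib]
        ring
    _ ≤ _ := by
        refine mul_le_mul_of_nonneg_left ?_ (by positivity)
        have h2 : 0 ≤ ∑ i, ‖M.v i k ω‖ ^ 2 := Finset.sum_nonneg fun i _ => sq_nonneg _
        have h3 : 0 ≤ ∑ j, ∑ i, ‖M.ξ j i k ω‖ ^ 2 :=
          Finset.sum_nonneg fun j _ => Finset.sum_nonneg fun i _ => sq_nonneg _
        have h4 := mul_nonneg (M.scale_nonneg (ρ := ρ) k ω) h3
        have h5 : 0 ≤ N * κ * V1 * ∑ i, ‖M.v i k ω‖ ^ 2 := by positivity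
        unfold noiseSq
        linarith

end NoiseBounds

end Model
end DecentralizedRegression
end

noncomputable section
namespace DecentralizedRegression

/-! ### The algorithm as an abstract stochastic recursion -/

namespace Model

variable {Ω : Type*} [mΩ : MeasurableSpace Ω] {N n : ℕ} {d : Fin N → ℕ} (M : Model Ω N n d)
variable {μ : Measure Ω} [IsProbabilityMeasure μ] {h : ℕ} {ρ : ℝ}
variable (a b : ℕ → ℝ) (init : Fin N → EuclideanSpace ℝ (Fin n))

theorem exists_noiseSq_bound (hA2 : M.NoiseAssumption μ) : ∃ β : ℝ, 0 ≤ β ∧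
    ∀ k, ∀ᵐ ω ∂μ, (μ[M.noiseSq k | M.enlargedPast k]) ω ≤ β := by
  obtain ⟨β, hβ⟩ := hA2.bounded
  refine ⟨max β 0, le_max_right _ _, fun k => M.condExp_noiseSq_le hA2 ?_⟩
  filter_upwards [hβ] with ω hω
  exact (hω k).trans (le_max_left _ _)

theorem stronglyMeasurable_error (k : ℕ) : StronglyMeasurable[M.past k] (M.error a b init k) :=
  (M.measurable_error a b init k).stronglyMeasurable

theorem stronglyMeasurable_weight (κ : ℝ) (k : ℕ) : StronglyMeasurable[M.enlargedPast k]
    fun ω => M.scale ρ k ω + κ * (‖M.error a b init k ω‖ ^ 2 + 1) := by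
  have h1 := (M.stronglyMeasurable_error a b init k).mono (M.past_le_enlargedPast k)
  exact (M.measurable_scale k k).stronglyMeasurable.add
    (((h1.norm.pow 2).add stronglyMeasurable_const).const_mul κ)

theorem weight_nonneg {κ : ℝ} (hκ : 0 ≤ κ) (k : ℕ) (ω : Ω) :
    0 ≤ M.scale ρ k ω + κ * (‖M.error a b init k ω‖ ^ 2 + 1) :=
  add_nonneg (M.scale_nonneg k ω) (by positivity)

theorem integrable_error_sq_add_one {k : ℕ} (he : MemLp (M.error a b init k) 2 μ) :
    Integrable (fun ω => ‖M.error a b init k ω‖ ^ 2 + 1) μ :=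
  (integrable_norm_sq_of_memLp he).add (integrable_const 1)

theorem integrable_weight (hb : M.UniformBound μ h ρ) (κ : ℝ) {k : ℕ}
    (he : MemLp (M.error a b init k) 2 μ) :
    Integrable (fun ω => M.scale ρ k ω + κ * (‖M.error a b init k ω‖ ^ 2 + 1)) μ :=
  (M.integrable_scale hb k).add ((M.integrable_error_sq_add_one a b init he).const_mul κ)

theorem integrable_weight_mul_noiseSq (hA2 : M.NoiseAssumption μ) (hb : M.UniformBound μ h ρ)
    {κ : ℝ} (hκ : 0 ≤ κ) {k : ℕ} (he : MemLp (M.error a b init k) 2 μ) :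
    Integrable (fun ω => (M.scale ρ k ω + κ * (‖M.error a b init k ω‖ ^ 2 + 1))
      * M.noiseSq k ω) μ := by
  obtain ⟨β, -, hβ⟩ := M.exists_noiseSq_bound hA2
  exact integrable_mul_of_condExp_le (M.enlargedPast_le k)
    (M.stronglyMeasurable_weight a b init κ k) (M.integrable_weight a b init hb κ he)
    (M.weight_nonneg a b init hκ k) (hA2.integrable_sq k) (M.noiseSq_nonneg k) (hβ k)

theorem measurable_observation_noise (k : ℕ) (i : Fin N) :
    Measurable fun ω => Matrix.toEuclideanLin (M.H i k ω).transpose (M.v i k ω) :=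
  measurable_toEuclideanLin_apply (B := fun ω => (M.H i k ω).transpose)
    (fun c r => M.measurable_H i k r c) (M.measurable_v i k)

theorem measurable_estimate' (k : ℕ) (i : Fin N) :
    Measurable fun ω => M.estimate a b (fun _ => 0) init k ω i :=
  (M.measurable_estimate a b _ init k i).mono (M.past_le k) le_rfl

theorem measurable_channel_noise (k : ℕ) (i j : Fin N) :
    Measurable fun ω => M.A k ω i j • M.f j i (M.estimate a b (fun _ => 0) init k ω j
        - M.estimate a b (fun _ => 0) init k ω i) • M.ξ j i k ω :=
  (M.measurable_A k i j).smul (((M.measurable_f j i).comp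
    ((M.measurable_estimate' a b init k j).sub (M.measurable_estimate' a b init k i))).smul
      (M.measurable_ξ j i k))

theorem measurable_noiseTerm (k : ℕ) : Measurable (M.noiseTerm a b init k) :=
  measurable_stack fun i => ((M.measurable_observation_noise k i).const_smul (a k)).add
    ((Finset.measurable_fun_sum Finset.univ fun j _ =>
      M.measurable_channel_noise a b init k i j).const_smul (b k))

theorem memLp_observation_noise (hA2 : M.NoiseAssumption μ) (hb : M.UniformBound μ h ρ) {k : ℕ}
    (he : MemLp (M.error a b init k) 2 μ) (i : Fin N) :
    MemLp (fun ω => Matrix.toEuclideanLin (M.H i k ω).transpose (M.v i k ω)) 2 μ := by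
  refine memLp_two_of_norm_sq_le (M.measurable_observation_noise k i).aestronglyMeasurable
    (M.integrable_weight_mul_noiseSq a b init hA2 hb le_rfl he) (ae_of_all _ fun ω => ?_)
  rw [zero_mul, add_zero]
  exact (M.norm_transpose_H_sq_le k ω i _).trans
    (mul_le_mul (M.norm_gram_le_scale k ω) (M.norm_v_sq_le_noiseSq k ω i) (by positivity)
      (M.scale_nonneg k ω))

theorem memLp_channel_noise (hA1 : M.LinearGrowth) (hA2 : M.NoiseAssumption μ)
    (hb : M.UniformBound μ h ρ) {k : ℕ} (he : MemLp (M.error a b init k) 2 μ) (i j : Fin N) :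
    MemLp (fun ω => M.A k ω i j • M.f j i (M.estimate a b (fun _ => 0) init k ω j
        - M.estimate a b (fun _ => 0) init k ω i) • M.ξ j i k ω) 2 μ := by
  obtain ⟨σ, c, hf⟩ := hA1
  refine memLp_two_of_norm_sq_le (M.measurable_channel_noise a b init k i j).aestronglyMeasurable
    (M.integrable_weight_mul_noiseSq a b init hA2 hb
      (κ := ρ ^ 2 * (8 * σ ^ 2 + 2 * c ^ 2)) (by positivity) he) ?_
  filter_upwards [M.norm_laplacian_le hb] with ω hω
  refine (M.norm_sq_channel_le a b init hf (hω k) i j).trans ?_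
  refine mul_le_mul ?_ (M.norm_ξ_sq_le_noiseSq k ω j i) (by positivity)
    (M.weight_nonneg a b init (by positivity) k ω)
  linarith [M.scale_nonneg (ρ := ρ) k ω]

theorem memLp_noiseTerm (hA1 : M.LinearGrowth) (hA2 : M.NoiseAssumption μ)
    (hb : M.UniformBound μ h ρ) {k : ℕ} (he : MemLp (M.error a b init k) 2 μ) :
    MemLp (M.noiseTerm a b init k) 2 μ := by
  obtain ⟨σ, c, hf⟩ := hA1
  refine memLp_two_of_norm_sq_le (M.measurable_noiseTerm a b init k).aestronglyMeasurable
    ((M.integrable_weight_mul_noiseSq a b init hA2 hb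
      (κ := N * (ρ ^ 2 * (8 * σ ^ 2 + 2 * c ^ 2))) (by positivity) he).const_mul (a k ^ 2 + b k ^ 2)) ?_
  filter_upwards [M.norm_laplacian_le hb] with ω hω
  exact M.norm_sq_noiseTerm_le a b init hf (hω k)

theorem setIntegral_scale_le (hb : M.UniformBound μ h ρ) (k : ℕ) {S : Set Ω}
    (hS : MeasurableSet[M.past k] S) :
    ∫ ω in S, M.scale ρ k ω ∂μ
      ≤ (ρ ^ 2 + 2 + ρ ^ (2 ^ max h 2)) * ∫ _ in S, (1 : ℝ) ∂μ := by
  have := setIntegral_mul_le_of_condExp_le (M.past_le k) (X := fun _ => 1)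
    stronglyMeasurable_const (integrable_const 1) (fun _ => zero_le_one)
    (M.integrable_scale hb k) (M.scale_nonneg k) (M.condExp_scale_le hb k) hS
  simpa only [one_mul] using this

/-- Two successive conditionings: given the enlarged past, the noise energy is replaced by β; then,
given the past alone, the random scale is replaced by its bound. -/
theorem exists_setIntegral_noiseTerm_le (hA1 : M.LinearGrowth) (hA2 : M.NoiseAssumption μ)
    (hρ : 0 ≤ ρ) (hb : M.UniformBound μ h ρ) : ∃ C, 0 ≤ C ∧ ∀ k, MemLp (M.error a b init k) 2 μ →
    ∀ S, MeasurableSet[M.past k] S → ∫ ω in S, ‖M.noiseTerm a b init k ω‖ ^ 2 ∂μ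
      ≤ C * (a k ^ 2 + b k ^ 2) * ∫ ω in S, (‖M.error a b init k ω‖ ^ 2 + 1) ∂μ := by
  obtain ⟨β, hβ0, hβ⟩ := M.exists_noiseSq_bound hA2
  obtain ⟨σ, c, hf⟩ := id hA1
  set κ := N * (ρ ^ 2 * (8 * σ ^ 2 + 2 * c ^ 2))
  have hκ : 0 ≤ κ := by positivity
  set C₁ := ρ ^ 2 + 2 + ρ ^ (2 ^ max h 2)
  have hC0 : 0 ≤ C₁ := by positivity
  refine ⟨β * (C₁ + κ), by positivity, fun k he S hS => ?_⟩
  have hX := M.integrable_weight_mul_noiseSq a b init hA2 hb hκ he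
  have h1 : ∫ ω in S, ‖M.noiseTerm a b init k ω‖ ^ 2 ∂μ ≤
      ∫ ω in S, (a k ^ 2 + b k ^ 2) * ((M.scale ρ k ω
        + κ * (‖M.error a b init k ω‖ ^ 2 + 1)) * M.noiseSq k ω) ∂μ := by
    refine integral_mono_ae
      (integrable_norm_sq_of_memLp (M.memLp_noiseTerm a b init hA1 hA2 hb he)).integrableOn
      (hX.const_mul _).integrableOn (ae_restrict_of_ae ?_)
    filter_upwards [M.norm_laplacian_le hb] with ω hω
    exact M.norm_sq_noiseTerm_le a b init hf (hω k)
  rw [integral_const_mul] at h1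
  have h2 := setIntegral_mul_le_of_condExp_le (M.enlargedPast_le k)
    (M.stronglyMeasurable_weight a b init κ k) (M.integrable_weight a b init hb κ he)
    (M.weight_nonneg a b init hκ k) (hA2.integrable_sq k) (M.noiseSq_nonneg k) (hβ k)
    (M.past_le_enlargedPast k S hS)
  have hi := M.integrable_error_sq_add_one a b init he
  rw [integral_add (M.integrable_scale hb k).integrableOn (hi.const_mul κ).integrableOn,
    integral_const_mul] at h2
  have h3 := M.setIntegral_scale_le hb k hS
  have h4 : ∫ _ in S, (1 : ℝ) ∂μ ≤ ∫ ω in S, (‖M.error a b init k ω‖ ^ 2 + 1) ∂μ :=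
    integral_mono (integrable_const _) hi.integrableOn fun ω => by simp
  have h5 := mul_le_mul_of_nonneg_left h4 hC0
  set Y := ∫ ω in S, (‖M.error a b init k ω‖ ^ 2 + 1) ∂μ
  calc _ ≤ _ := h1
    _ ≤ (a k ^ 2 + b k ^ 2) * (β * ((C₁ + κ) * Y)) := by
        refine mul_le_mul_of_nonneg_left (h2.trans ?_) (by positivity)
        refine mul_le_mul_of_nonneg_left ?_ hβ0
        linarith
    _ = _ := by ring

/-- Everything multiplying a noise, namely Hᵀ or a weight times an intensity, is moved to the other
side of the inner product. There it is measurable with respect to the enlarged past, given which the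
noise has mean zero. -/
theorem setIntegral_inner_noiseTerm_eq_zero (hA1 : M.LinearGrowth) (hA2 : M.NoiseAssumption μ)
    (hb : M.UniformBound μ h ρ) {k : ℕ} (he : MemLp (M.error a b init k) 2 μ)
    {z : Ω → EuclideanSpace ℝ (Fin N × Fin n)} (hz : Measurable[M.enlargedPast k] z)
    (hz2 : MemLp z 2 μ) {S : Set Ω} (hS : MeasurableSet[M.enlargedPast k] S) :
    ∫ ω in S, inner ℝ (z ω) (M.noiseTerm a b init k ω) ∂μ = 0 := by
  have hle := M.enlargedPast_le k
  have hzi : ∀ i, Measurable[M.enlargedPast k] fun ω => block (z ω) i := measurable_block hz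
  have hzi2 : ∀ i, MemLp (fun ω => block (z ω) i) 2 μ := fun i =>
    hz2.mono ((hzi i).mono hle le_rfl).aestronglyMeasurable
      (ae_of_all _ fun ω => norm_block_le (z ω) i)
  have hr := M.regressorSigma_le_enlargedPast k k
  have hH := fun i r c => (M.measurable_H_regressorSigma k i r c).mono hr le_rfl
  have hA := fun i j => (M.measurable_A_regressorSigma k i j).mono hr le_rfl
  have hx : ∀ i, Measurable[M.enlargedPast k] fun ω => M.estimate a b (fun _ => 0) init k ω i :=
    fun i => (M.measurable_estimate a b _ init k i).mono (M.past_le_enlargedPast k) le_rfl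
  have i1 : ∀ i, Integrable (fun ω => inner ℝ (block (z ω) i)
      (Matrix.toEuclideanLin (M.H i k ω).transpose (M.v i k ω))) μ := fun i =>
    integrable_inner_of_memLp (hzi2 i) (M.memLp_observation_noise a b init hA2 hb he i)
  have i2 : ∀ i j, Integrable (fun ω => inner ℝ (block (z ω) i)
      (M.A k ω i j • M.f j i (M.estimate a b (fun _ => 0) init k ω j
        - M.estimate a b (fun _ => 0) init k ω i) • M.ξ j i k ω)) μ := fun i j =>
    integrable_inner_of_memLp (hzi2 i) (M.memLp_channel_noise a b init hA1 hA2 hb he i j)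
  have z1 : ∀ i, ∫ ω in S, inner ℝ (block (z ω) i)
      (Matrix.toEuclideanLin (M.H i k ω).transpose (M.v i k ω)) ∂μ = 0 := by
    intro i
    have hm := i1 i
    simp only [inner_toEuclideanLin_transpose] at hm ⊢
    refine setIntegral_inner_eq_zero_of_condExp hle
      (measurable_toEuclideanLin_apply (hH i) (hzi i)).stronglyMeasurable
      ((hA2.martingale_v i).integrable k) hm
      (M.condExp_enlargedPast_eq_zero hA2.indep ?_ ((hA2.martingale_v i).integrable k)
        ((hA2.martingale_v i).condExp_eq_zero k)) hS
    exact ((M.measurable_v_noiseSigma k i).mono (le_iSup M.noiseSigma k)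
      le_rfl).stronglyMeasurable
  have z2 : ∀ i j, ∫ ω in S, inner ℝ (block (z ω) i)
      (M.A k ω i j • M.f j i (M.estimate a b (fun _ => 0) init k ω j
        - M.estimate a b (fun _ => 0) init k ω i) • M.ξ j i k ω) ∂μ = 0 := by
    intro i j
    have hm := i2 i j
    have heq : ∀ ω, inner ℝ (block (z ω) i)
        (M.A k ω i j • M.f j i (M.estimate a b (fun _ => 0) init k ω j
          - M.estimate a b (fun _ => 0) init k ω i) • M.ξ j i k ω)
        = inner ℝ ((M.A k ω i j * M.f j i (M.estimate a b (fun _ => 0) init k ω j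
          - M.estimate a b (fun _ => 0) init k ω i)) • block (z ω) i) (M.ξ j i k ω) := fun ω => by
      rw [smul_smul, inner_smul_left, inner_smul_right]; rfl
    simp only [heq] at hm ⊢
    refine setIntegral_inner_eq_zero_of_condExp hle
      ((M.measurable_noiseTerm_summand hA hx i j).smul (hzi i)).stronglyMeasurable
      ((hA2.martingale_ξ j i).integrable k) hm
      (M.condExp_enlargedPast_eq_zero hA2.indep ?_ ((hA2.martingale_ξ j i).integrable k)
        ((hA2.martingale_ξ j i).condExp_eq_zero k)) hS
    exact ((M.measurable_ξ_noiseSigma k j i).mono (le_iSup M.noiseSigma k)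
      le_rfl).stronglyMeasurable
  have hsplit : ∀ ω, inner ℝ (z ω) (M.noiseTerm a b init k ω) = ∑ i, (a k *
      inner ℝ (block (z ω) i) (Matrix.toEuclideanLin (M.H i k ω).transpose (M.v i k ω))
      + b k * ∑ j, inner ℝ (block (z ω) i)
        (M.A k ω i j • M.f j i (M.estimate a b (fun _ => 0) init k ω j
          - M.estimate a b (fun _ => 0) init k ω i) • M.ξ j i k ω)) := fun ω => by
    rw [noiseTerm, inner_stack]
    refine Finset.sum_congr rfl fun i _ => ?_
    rw [inner_add_right, real_inner_smul_right, real_inner_smul_right, inner_sum]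
  simp_rw [hsplit]
  have i3 : ∀ i, Integrable (fun ω => ∑ j, inner ℝ (block (z ω) i)
      (M.A k ω i j • M.f j i (M.estimate a b (fun _ => 0) init k ω j
        - M.estimate a b (fun _ => 0) init k ω i) • M.ξ j i k ω)) μ := fun i =>
    integrable_finsetSum _ fun j _ => i2 i j
  rw [integral_finsetSum]
  · refine Finset.sum_eq_zero fun i _ => ?_
    rw [integral_add ((i1 i).const_mul _).integrableOn ((i3 i).const_mul _).integrableOn,
      integral_const_mul, integral_const_mul, z1, integral_finsetSum _ fun j _ =>
        (i2 i j).integrableOn, Finset.sum_eq_zero fun j _ => z2 i j]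
    simp
  · exact fun i _ => (((i1 i).const_mul _).add ((i3 i).const_mul _)).integrableOn

theorem stronglyMeasurable_drift (k : ℕ) :
    StronglyMeasurable fun ω => Matrix.toEuclideanCLM (𝕜 := ℝ) (M.drift a b k ω) :=
  stronglyMeasurable_toEuclideanCLM
    (M.measurable_drift_of a b (M.measurable_A k) fun i => M.measurable_H i k)

theorem exists_isStochasticRecursion (hA1 : M.LinearGrowth) (hA2 : M.NoiseAssumption μ)
    (hρ : 0 ≤ ρ) (hb : M.UniformBound μ h ρ) : ∃ C,
    IsStochasticRecursion μ M.pastFiltration (M.error a b init)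
      (fun k ω => Matrix.toEuclideanCLM (𝕜 := ℝ) (M.drift a b k ω)) (M.noiseTerm a b init)
      (M.scale ρ) (fun k => a k ^ 2 + b k ^ 2) C := by
  obtain ⟨C, hC0, hC⟩ := M.exists_setIntegral_noiseTerm_le a b init hA1 hA2 hρ hb
  have hρp : 0 ≤ ρ ^ (2 ^ max h 2) := by positivity
  refine ⟨(ρ ^ 2 + 2 + ρ ^ (2 ^ max h 2)) + C, ?_⟩
  exact
    { e_meas := M.stronglyMeasurable_error a b init
      D_meas := M.stronglyMeasurable_drift a b
      memLp_zero := memLp_const (stack fun i => init i - M.x₀)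
      step := M.error_succ a b init
      g_nonneg := fun k => by positivity
      C_nonneg := by positivity
      D_bound := fun k => by
        filter_upwards [M.norm_laplacian_le hb] with ω hω
        rw [Matrix.l2_opNorm_toEuclideanCLM]
        refine (M.norm_drift_sq_le a b k ω).trans ?_
        have := pow_le_pow_left₀ (norm_nonneg _) (hω k) 2
        unfold scale
        gcongr
        linarith
      G_nonneg := M.scale_nonneg
      G_integrable := M.integrable_scale hb
      G_condExp := fun k => by
        filter_upwards [M.condExp_scale_le hb k] with ω hω
        exact hω.trans (by linarith)
      m_memLp := fun k he => M.memLp_noiseTerm a b init hA1 hA2 hb he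
      m_sq := fun k he S hS => by
        refine (hC k he S hS).trans ?_
        have : 0 ≤ ∫ ω in S, (‖M.error a b init k ω‖ ^ 2 + 1) ∂μ :=
          integral_nonneg fun ω => by positivity
        gcongr
        have := sq_nonneg ρ
        linarith
      -- The drift at instant k is not known to the past, but it is to the enlarged past, so the
      -- noiseless update is an admissible test vector.
      cross := fun k he hDe S hS => by
        have hle := M.past_le_enlargedPast k
        have hr := M.regressorSigma_le_enlargedPast k k
        have hem := (M.measurable_error a b init k).mono hle le_rfl
        refine M.setIntegral_inner_noiseTerm_eq_zero a b init hA1 hA2 hb he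
          (hem.sub ?_) (he.sub hDe) (hle S hS)
        exact measurable_toEuclideanLin_apply (M.measurable_drift_of a b
          (fun i j => (M.measurable_A_regressorSigma k i j).mono hr le_rfl)
          fun i r c => (M.measurable_H_regressorSigma k i r c).mono hr le_rfl) hem }

end Model
end DecentralizedRegression
end

noncomputable section
namespace DecentralizedRegression

/-! ### Conditional quadratic forms and the information matrix -/

section QuadraticForm

variable {Ω ι : Type*} {m : MeasurableSpace Ω} [mΩ : MeasurableSpace Ω] [Fintype ι] [DecidableEq ι] {μ : Measure Ω}

theorem inner_toEuclideanCLM_eq_sum (B : Matrix ι ι ℝ) (x : EuclideanSpace ℝ ι) :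
    inner ℝ x (Matrix.toEuclideanCLM (𝕜 := ℝ) B x) = ∑ p, ∑ q, x p * x q * B p q := by
  rw [Matrix.inner_toEuclideanCLM]
  simp only [dotProduct, Matrix.mulVec, Finset.mul_sum]
  exact Finset.sum_congr rfl fun p _ => Finset.sum_congr rfl fun q _ => by ring

theorem condExp_inner_toEuclideanCLM {X : Ω → Matrix ι ι ℝ}
    {x : Ω → EuclideanSpace ℝ ι} (hx : Measurable[m] x)
    (hX : ∀ p q, Integrable (fun ω => X ω p q) μ)
    (hxX : ∀ p q, Integrable (fun ω => x ω p * x ω q * X ω p q) μ) :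
    μ[fun ω => inner ℝ (x ω) (Matrix.toEuclideanCLM (𝕜 := ℝ) (X ω) (x ω)) | m]
      =ᵐ[μ] fun ω => inner ℝ (x ω)
        (Matrix.toEuclideanCLM (𝕜 := ℝ) (condExpMatrix μ m X ω) (x ω)) := by
  simp_rw [inner_toEuclideanCLM_eq_sum]
  have h1 : (fun ω => ∑ p, ∑ q, x ω p * x ω q * X ω p q)
      = ∑ r : ι × ι, fun ω => x ω r.1 * x ω r.2 * X ω r.1 r.2 := by
    funext ω
    rw [Finset.sum_apply, Fintype.sum_prod_type]
  rw [h1]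
  refine (condExp_finsetSum (fun r _ => hxX r.1 r.2) m).trans ?_
  have h2 : ∀ r : ι × ι, μ[fun ω => x ω r.1 * x ω r.2 * X ω r.1 r.2 | m]
      =ᵐ[μ] fun ω => x ω r.1 * x ω r.2 * (μ[fun ω => X ω r.1 r.2 | m]) ω := fun r =>
    condExp_mul_of_stronglyMeasurable_left
      ((measurable_euclideanSpace_apply hx r.1).mul
        (measurable_euclideanSpace_apply hx r.2)).stronglyMeasurable (hxX r.1 r.2) (hX r.1 r.2)
  filter_upwards [ae_all_iff.2 h2] with ω hω
  rw [Finset.sum_apply, Fintype.sum_prod_type]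
  refine Finset.sum_congr rfl fun p _ => Finset.sum_congr rfl fun q _ => ?_
  rw [hω (p, q)]
  rfl

end QuadraticForm

namespace Model

variable {Ω : Type*} [mΩ : MeasurableSpace Ω] {N n : ℕ} {d : Fin N → ℕ} (M : Model Ω N n d)
variable {μ : Measure Ω} [IsProbabilityMeasure μ] {h : ℕ} {ρ : ℝ}
variable (a b : ℕ → ℝ) (init : Fin N → EuclideanSpace ℝ (Fin n))

theorem symLaplacian_comm (k : ℕ) (ω : Ω) (i j : Fin N) :
    M.symLaplacian k ω i j = M.symLaplacian k ω j i := by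
  simp [symLaplacian, add_comm]

theorem gram_comm (k : ℕ) (ω : Ω) (p q : Fin N × Fin n) : M.gram k ω p q = M.gram k ω q p := by
  have : (M.gram k ω).transpose = M.gram k ω := by
    simp [gram, Matrix.transpose_mul]
  exact congrFun (congrFun this q) p

theorem abs_symLaplacian_le (k : ℕ) (ω : Ω) (i j : Fin N) :
    |M.symLaplacian k ω i j| ≤ ‖M.laplacian k ω‖ := by
  have h1 := abs_entry_le_l2_opNorm (M.laplacian k ω) i j
  have h2 := abs_entry_le_l2_opNorm (M.laplacian k ω) j i
  simp only [symLaplacian, Matrix.smul_apply, Matrix.add_apply, Matrix.transpose_apply,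
    smul_eq_mul, abs_mul]
  rw [abs_of_pos (by norm_num : (0 : ℝ) < 2⁻¹)]
  linarith [abs_add_le (M.laplacian k ω i j) (M.laplacian k ω j i)]

theorem symDrift_apply (k : ℕ) (ω : Ω) (p q : Fin N × Fin n) :
    M.symDrift a b k ω p q = b k * (M.symLaplacian k ω p.1 q.1
      * (1 : Matrix (Fin n) (Fin n) ℝ) p.2 q.2) + a k * M.gram k ω p q := rfl

theorem abs_symDrift_le {k : ℕ} {ω : Ω} (hL : ‖M.laplacian k ω‖ ≤ ρ) (p q : Fin N × Fin n) :
    |M.symDrift a b k ω p q| ≤ (|a k| + |b k|) * M.scale ρ k ω := by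
  have h1 : |M.symLaplacian k ω p.1 q.1| ≤ M.scale ρ k ω := by
    refine ((M.abs_symLaplacian_le k ω _ _).trans hL).trans ?_
    unfold scale
    nlinarith [sq_nonneg (ρ - 1), sq_nonneg ‖M.gram k ω‖]
  have h2 : |M.gram k ω p q| ≤ M.scale ρ k ω :=
    (abs_entry_le_l2_opNorm _ p q).trans (M.norm_gram_le_scale k ω)
  have h3 : |(1 : Matrix (Fin n) (Fin n) ℝ) p.2 q.2| ≤ 1 := by
    rw [Matrix.one_apply]; split_ifs <;> simp
  rw [symDrift_apply]
  refine (abs_add_le _ _).trans ?_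
  rw [abs_mul, abs_mul, abs_mul, add_mul, add_comm]
  gcongr
  calc _ ≤ M.scale ρ k ω * 1 := by
        gcongr
        exact M.scale_nonneg k ω
    _ = _ := mul_one _

theorem measurable_symDrift (k : ℕ) (p q : Fin N × Fin n) :
    Measurable fun ω => M.symDrift a b k ω p q :=
  ((((M.measurable_symLaplacian k p.1 q.1).mul_const _).const_mul (b k))).add
    ((M.measurable_gram_of (fun i => M.measurable_H i k) p q).const_mul (a k))

theorem integrable_gram (hb : M.UniformBound μ h ρ) (k : ℕ) (p q : Fin N × Fin n) :
    Integrable (fun ω => M.gram k ω p q) μ :=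
  (M.integrable_scale hb k).mono'
    (M.measurable_gram_of (fun i => M.measurable_H i k) p q).aestronglyMeasurable
    (ae_of_all _ fun ω => (abs_entry_le_l2_opNorm _ p q).trans (M.norm_gram_le_scale k ω))

theorem integrable_symLaplacian (hb : M.UniformBound μ h ρ) (k : ℕ) (i j : Fin N) :
    Integrable (fun ω => M.symLaplacian k ω i j) μ := by
  refine (integrable_const ρ).mono' (M.measurable_symLaplacian k i j).aestronglyMeasurable ?_
  filter_upwards [M.norm_laplacian_le hb] with ω hω
  exact (M.abs_symLaplacian_le k ω i j).trans (hω k)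

theorem integrable_symDrift (hb : M.UniformBound μ h ρ) (k : ℕ) (p q : Fin N × Fin n) :
    Integrable (fun ω => M.symDrift a b k ω p q) μ :=
  (((M.integrable_symLaplacian hb k p.1 q.1).mul_const _).const_mul (b k)).add
    ((M.integrable_gram hb k p q).const_mul (a k))

/-- The matrix whose least eigenvalue is `infoEigenvalue`. -/
def infoMatrix (μ : Measure Ω) (h k : ℕ) (ω : Ω) : Matrix (Fin N × Fin n) (Fin N × Fin n) ℝ :=
  ∑ i ∈ Finset.Ico (k * h) ((k + 1) * h),
    (b i • (condExpMatrix μ (M.past (k * h)) (M.symLaplacian i) ω ⊗ₖ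
        (1 : Matrix (Fin n) (Fin n) ℝ))
      + a i • condExpMatrix μ (M.past (k * h)) (M.gram i) ω)

theorem infoMatrix_apply (μ : Measure Ω) (h k : ℕ) (ω : Ω) (p q : Fin N × Fin n) :
    M.infoMatrix a b μ h k ω p q = ∑ i ∈ Finset.Ico (k * h) ((k + 1) * h),
      (b i * ((μ[fun ω => M.symLaplacian i ω p.1 q.1 | M.past (k * h)]) ω
          * (1 : Matrix (Fin n) (Fin n) ℝ) p.2 q.2)
        + a i * (μ[fun ω => M.gram i ω p q | M.past (k * h)]) ω) := by
  rw [infoMatrix, Matrix.sum_apply]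
  rfl

/-- Transposed entries are conditional expectations of the same function, so symmetry holds at every
ω and not merely almost everywhere. -/
theorem isHermitian_infoMatrix (μ : Measure Ω) (h k : ℕ) (ω : Ω) :
    (M.infoMatrix a b μ h k ω).IsHermitian := by
  ext p q
  rw [Matrix.conjTranspose_apply, star_trivial, infoMatrix_apply, infoMatrix_apply]
  have h1 : ∀ i, (fun ω => M.symLaplacian i ω q.1 p.1) = fun ω => M.symLaplacian i ω p.1 q.1 :=
    fun i => funext fun ω => M.symLaplacian_comm i ω _ _
  have h2 : ∀ i, (fun ω => M.gram i ω q p) = fun ω => M.gram i ω p q :=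
    fun i => funext fun ω => M.gram_comm i ω _ _
  have h3 : (1 : Matrix (Fin n) (Fin n) ℝ) q.2 p.2 = (1 : Matrix (Fin n) (Fin n) ℝ) p.2 q.2 := by
    simp [Matrix.one_apply, eq_comm]
  simp_rw [h1, h2, h3]

theorem condExpMatrix_sum_symDrift (hb : M.UniformBound μ h ρ) (k : ℕ) :
    ∀ᵐ ω ∂μ, condExpMatrix μ (M.past (k * h))
      (fun ω => ∑ i ∈ Finset.Ico (k * h) ((k + 1) * h), M.symDrift a b i ω) ω
        = M.infoMatrix a b μ h k ω := by
  have key : ∀ r : (Fin N × Fin n) × (Fin N × Fin n), ∀ᵐ ω ∂μ,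
      condExpMatrix μ (M.past (k * h))
        (fun ω => ∑ i ∈ Finset.Ico (k * h) ((k + 1) * h), M.symDrift a b i ω) ω r.1 r.2
        = M.infoMatrix a b μ h k ω r.1 r.2 := by
    rintro ⟨p, q⟩
    have h1 : (fun ω => (∑ i ∈ Finset.Ico (k * h) ((k + 1) * h), M.symDrift a b i ω) p q)
        = ∑ i ∈ Finset.Ico (k * h) ((k + 1) * h), fun ω => M.symDrift a b i ω p q := by
      funext ω
      rw [Matrix.sum_apply, Finset.sum_apply]
    have h2 := condExp_finsetSum (μ := μ) (s := Finset.Ico (k * h) ((k + 1) * h))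
      (fun i _ => M.integrable_symDrift a b hb i p q) (M.past (k * h))
    set δ := (1 : Matrix (Fin n) (Fin n) ℝ) p.2 q.2 with hδ
    have h3 : ∀ i, μ[fun ω => M.symDrift a b i ω p q | M.past (k * h)] =ᵐ[μ] fun ω =>
        b i * ((μ[fun ω => M.symLaplacian i ω p.1 q.1 | M.past (k * h)]) ω * δ)
        + a i * (μ[fun ω => M.gram i ω p q | M.past (k * h)]) ω := by
      intro i
      have h4 : (fun ω => M.symDrift a b i ω p q)
          = (b i * δ) • (fun ω => M.symLaplacian i ω p.1 q.1)
            + a i • fun ω => M.gram i ω p q := by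
        funext ω
        rw [symDrift_apply]
        simp only [Pi.add_apply, Pi.smul_apply, smul_eq_mul, hδ]
        ring
      rw [h4]
      filter_upwards [condExp_add ((M.integrable_symLaplacian hb i p.1 q.1).smul (b i * δ))
          ((M.integrable_gram hb i p q).smul (a i)) (M.past (k * h)),
        condExp_smul (μ := μ) (b i * δ) (fun ω => M.symLaplacian i ω p.1 q.1) (M.past (k * h)),
        condExp_smul (μ := μ) (a i) (fun ω => M.gram i ω p q) (M.past (k * h))] with ω e1 e2 e3
      rw [e1, Pi.add_apply, e2, e3]
      simp only [Pi.smul_apply, smul_eq_mul]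
      ring
    filter_upwards [h2, ae_all_iff.2 h3] with ω e1 e2
    rw [infoMatrix_apply]
    simp only [condExpMatrix, Matrix.of_apply]
    rw [h1, e1, Finset.sum_apply]
    exact Finset.sum_congr rfl fun i _ => e2 i
  filter_upwards [ae_all_iff.2 key] with ω hω
  ext p q
  exact hω (p, q)

/-- The error at the start of the block is known to the past, so conditioning acts only on the
matrix entries; the eigenvalue bound then applies to the resulting information matrix. -/
theorem infoEigenvalue_mul_le {C : ℝ}
    (hR : IsStochasticRecursion μ M.pastFiltration (M.error a b init)
      (fun k ω => Matrix.toEuclideanCLM (𝕜 := ℝ) (M.drift a b k ω)) (M.noiseTerm a b init)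
      (M.scale ρ) (fun k => a k ^ 2 + b k ^ 2) C)
    (hb : M.UniformBound μ h ρ) (k : ℕ) :
    ∀ᵐ ω ∂μ, M.infoEigenvalue μ a b h k ω * ‖M.error a b init (k * h) ω‖ ^ 2 ≤
      (μ[fun ω => ∑ l ∈ Finset.range h, inner ℝ (M.error a b init (k * h) ω)
        (Matrix.toEuclideanCLM (𝕜 := ℝ) (M.drift a b (k * h + l) ω)
          (M.error a b init (k * h) ω)) | M.past (k * h)]) ω := by
  set x := M.error a b init (k * h) with hx
  set X : Ω → Matrix (Fin N × Fin n) (Fin N × Fin n) ℝ := fun ω =>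
    ∑ i ∈ Finset.Ico (k * h) ((k + 1) * h), M.symDrift a b i ω with hXdef
  have h1 : (fun ω => ∑ l ∈ Finset.range h, inner ℝ (x ω)
        (Matrix.toEuclideanCLM (𝕜 := ℝ) (M.drift a b (k * h + l) ω) (x ω)))
      = fun ω => inner ℝ (x ω) (Matrix.toEuclideanCLM (𝕜 := ℝ) (X ω) (x ω)) := by
    funext ω
    simp only [inner_drift_eq_inner_symDrift]
    simp only [hXdef]
    rw [Finset.sum_Ico_eq_sum_range, add_mul, one_mul, Nat.add_sub_cancel_left, map_sum,
      sum_apply, inner_sum]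
  have hXa : ∀ ω p q, X ω p q = ∑ i ∈ Finset.Ico (k * h) ((k + 1) * h), M.symDrift a b i ω p q :=
    fun ω p q => Matrix.sum_apply _ _ _ _
  rw [h1]
  have h2 := condExp_inner_toEuclideanCLM (μ := μ) (m := M.past (k * h)) (X := X) (x := x)
    (M.measurable_error a b init (k * h))
    (fun p q => by
      simp only [hXa]
      exact integrable_finsetSum _ fun i _ => M.integrable_symDrift a b hb i p q)
    (fun p q => by
      simp only [hXa, Finset.mul_sum]
      refine integrable_finsetSum _ fun i hi => ?_
      have hle := M.past_mono (Finset.mem_Ico.1 hi).1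
      have hxm := M.measurable_error a b init (k * h)
      have hxm' := hxm.mono (M.past_le _) le_rfl
      -- Entries of the drift are not bounded. Integrability against products of error coordinates
      -- again comes from the conditional bound on the scale, valid because the block starts no
      -- later than `i`.
      refine ((hR.integrable_mul_G (i := i) (X := fun ω => ‖x ω‖ ^ 2)
        ((hxm.stronglyMeasurable.mono hle).norm.pow 2) (hR.integrable_norm_sq _)
        (fun ω => by positivity)).const_mul (|a i| + |b i|)).mono'
        (((measurable_euclideanSpace_apply hxm' p).mul
          (measurable_euclideanSpace_apply hxm' q)).mul
            (M.measurable_symDrift a b i p q)).aestronglyMeasurable ?_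
      filter_upwards [M.norm_laplacian_le hb] with ω hω
      rw [norm_mul, norm_mul]
      have e1 := PiLp.norm_apply_le (x ω) p
      have e2 := PiLp.norm_apply_le (x ω) q
      have e3 := M.abs_symDrift_le a b (hω i) p q
      calc ‖x ω p‖ * ‖x ω q‖ * ‖M.symDrift a b i ω p q‖
          ≤ ‖x ω‖ * ‖x ω‖ * ((|a i| + |b i|) * M.scale ρ i ω) := by
            gcongr
            exact e3
        _ = _ := by ring)
  filter_upwards [h2, M.condExpMatrix_sum_symDrift a b hb k] with ω e1 e2
  rw [e1, e2]
  exact lambdaMin_mul_norm_sq_le (M.isHermitian_infoMatrix a b μ h k ω) (x ω)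

theorem tendsto_estimate_of_error {ω : Ω}
    (he : Tendsto (fun k => M.error a b init k ω) atTop (𝓝 0)) (i : Fin N) :
    Tendsto (fun k => M.estimate a b (fun _ => 0) init k ω i) atTop (𝓝 M.x₀) := by
  rw [tendsto_iff_norm_sub_tendsto_zero]
  refine squeeze_zero (fun k => norm_nonneg _) (fun k => ?_)
    (tendsto_zero_iff_norm_tendsto_zero.1 he)
  exact norm_le_norm_stack (fun i => M.estimate a b (fun _ => 0) init k ω i - M.x₀) i

end Model
end DecentralizedRegression
end

theorem corollary1 {Ω : Type*} [MeasurableSpace Ω] (μ : Measure Ω) [IsProbabilityMeasure μ]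
    {N n : ℕ} {d : Fin N → ℕ} (M : DecentralizedRegression.Model Ω N n d)
    (a b : ℕ → ℝ) (init : Fin N → EuclideanSpace ℝ (Fin n))
    (hA1 : M.LinearGrowth) (hA2 : M.NoiseAssumption μ)
    (h : ℕ) (hh : 0 < h) (ρ : ℝ) (hρ : 0 < ρ)
    (hsum : ∀ᵐ ω ∂μ, Tendsto
      (fun K => ∑ k ∈ Finset.range K, M.infoEigenvalue μ a b h k ω) atTop atTop)
    (hnonneg : ∀ᵐ ω ∂μ, ∀ k, 0 ≤ M.infoEigenvalue μ a b h k ω)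
    (hgains : Summable fun k => a k ^ 2 + b k ^ 2)
    (hbound : M.UniformBound μ h ρ) :
    ∀ᵐ ω ∂μ, ∀ i, Tendsto (fun k => M.estimate a b (fun _ => 0) init k ω i) atTop (𝓝 M.x₀) := by
  obtain ⟨C, hR⟩ := M.exists_isStochasticRecursion a b init hA1 hA2 hρ.le hbound
  filter_upwards [hR.ae_tendsto_zero hgains hh hnonneg hsum
    (M.infoEigenvalue_mul_le a b init hR hbound)] with ω hω i
  exact M.tendsto_estimate_of_error a b init hω i
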